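/- Definitions. A function $\varphi:\mathbb R\to\mathbb C$ is an inner function if it is, almost everywhere, the boundary value of a bounded analytic function on the upper half-plane and $|\varphi(p)|=1$ for almost every $p\in\mathbb R$ (no symmetry is assumed); put $\check\varphi(p)=\overline{\varphi(-p)}$. Let $\mathcal H^1=\mathcal H_+\oplus\mathcal H_-=L^2(\mathbb R_+,2\pi\,dp)\oplus L^2(\mathbb R_+,2\pi\,dq)$ be the one-particle space of the free complex fermion in momentum space, $P_\pm$ the multiplication by the momentum on $\mathcal H_\pm$, and $\mathcal H$ the antisymmetric Fock space over $\mathcal H^1$. On $\mathcal H^1\otimes\mathcal H^1$ let $$M_\varphi=\varphi(P_+\otimes P_+)\oplus\check\varphi(P_+\otimes P_-)\oplus\check\varphi(P_-\otimes P_+)\oplus\varphi(P_-\otimes P_-),$$ and let $S_\varphi=\bigoplus_{m,n}\prod_{i,j}(M_\varphi)^{m,n}_{i,j}$, where $(M_\varphi)^{m,n}_{i,j}$ acts on $(\mathcal H^1)^{\otimes m}\otimes(\mathcal H^1)^{\otimes n}$ as $M_\varphi$ on the $i$-th factor of the first and the $j$-th factor of the second tensor power; $S_\varphi$ is the identity if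 $m=0$ or $n=0$. It restricts to a unitary operator on $\mathcal H\otimes\mathcal H$. Let $V(\theta)$ be the gauge action on $\mathcal H$, the second quantization of $e^{i\theta}$ on $\mathcal H_+$ and $e^{-i\theta}$ on $\mathcal H_-$. The tensor product $\mathcal H_{\mathrm b}\otimes\mathcal H_{\mathrm b}$ of two bosonic Fock spaces of the $\mathrm U(1)$-current is identified with the space of vectors of $\mathcal H\otimes\mathcal H$ fixed by all $V(\theta)\otimes V(\theta')$. Its bosonic $1+1$ particle space $\mathcal H^1_{\mathrm b}\otimes\mathcal H^1_{\mathrm b}=L^2(\mathbb R_+,p\,dp)\otimes L^2(\mathbb R_+,\bar p\,d\bar p)$ is embedded isometrically by $$\Psi\mapsto \tfrac1{(2\pi)^2}\Psi(p+q,\bar p+\bar q),$$ a wave function of one particle of charge $+$ (momentum $p$, respectively $\bar p$) and one of charge $-$ (momentum $q$, respectively $\bar q$) in each of the two factors. Proposition. Let $\varphi$ be an inner function. Then $S_\varphi(\mathcal H^1_{\mathrm b}\otimes\mathcal H^1_{\mathrm b})\subset\mathcal H^1_{\mathrm b}\otimes\mathcal H^1_{\mathrm b}$ if and only if there are $\kappa,\theta\in\mathbb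 R$ with $\varphi(p)=e^{i(\kappa p+\theta)}$ for almost every $p\in\mathbb R$. Hence, if $\varphi$ is not of this form, $S_\varphi$ mixes bosonic particle numbers: there is $\Psi\in\mathcal H^1_{\mathrm b}\otimes\mathcal H^1_{\mathrm b}$ such that $S_\varphi\Psi=\Phi+X$ with $\Phi\in\mathcal H^1_{\mathrm b}\otimes\mathcal H^1_{\mathrm b}$ and a non-zero $X\in\mathcal H_{\mathrm b}\otimes\mathcal H_{\mathrm b}$ which is orthogonal to $\mathcal H^1_{\mathrm b}\otimes\mathcal H^1_{\mathrm b}$. -/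

import Mathlib

open MeasureTheory
open scoped ENNReal Topology ComplexConjugate

noncomputable section

namespace FermiScattering

/-! ## Inner functions on the upper half-plane -/

/-- `φ : ℝ → ℂ` is (a representative of) an inner function: it is almost everywhere the boundary
value of a bounded analytic function on the upper half-plane, and has modulus `1` almost
everywhere. No symmetry is required. -/
def IsInnerFunction (φ : ℝ → ℂ) : Prop :=
  ∃ F : ℂ → ℂ, DifferentiableOn ℂ F {z | 0 < z.im} ∧
    (∃ C : ℝ, ∀ z : ℂ, 0 < z.im → ‖F z‖ ≤ C) ∧
    ∀ᵐ x : ℝ, Filter.Tendsto (fun y : ℝ => F (x + y * Complex.I)) (𝓝[>] 0) (𝓝 (φ x)) ∧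
      ‖φ x‖ = 1

/-- `φ` is almost everywhere of the form `p ↦ exp (i (κ p + θ))` with `κ, θ` real. -/
def IsExponential (φ : ℝ → ℂ) : Prop :=
  ∃ κ θ : ℝ, ∀ᵐ p : ℝ, φ p = Complex.exp (Complex.I * (κ * p + θ))

/-- The function `p ↦ conj (φ (-p))`. -/
def check (φ : ℝ → ℂ) (p : ℝ) : ℂ := conj (φ (-p))

/-! ## Weighted composition operators between `L²` spaces -/

/-- The conditions on a map `T` and a weight `a` under which `f ↦ a · (f ∘ T)` is an isometry
from `L²(ρ)` to `L²(μ)`. -/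
structure IsIsometricWeight {Y Z : Type*} [MeasurableSpace Y] [MeasurableSpace Z]
    (T : Y → Z) (a : Y → ℂ) (μ : Measure Y) (ρ : Measure Z) : Prop where
  qmp : Measure.QuasiMeasurePreserving T μ ρ
  meas : AEStronglyMeasurable a μ
  iso : ∀ G : Z → ℝ≥0∞, Measurable G → ∫⁻ y, ‖a y‖ₑ ^ 2 * G (T y) ∂μ = ∫⁻ z, G z ∂ρ

section Weighted

variable {Y Z : Type*} [MeasurableSpace Y] [MeasurableSpace Z]
  {T : Y → Z} {a : Y → ℂ} {μ : Measure Y} {ρ : Measure Z}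

theorem IsIsometricWeight.eLpNorm_eq (h : IsIsometricWeight T a μ ρ) (f : Z → ℂ)
    (hf : AEStronglyMeasurable f ρ) :
    eLpNorm (fun y => a y * f (T y)) 2 μ = eLpNorm f 2 ρ := by
  have key : ∫⁻ y, ‖a y * f (T y)‖ₑ ^ (2 : ℝ) ∂μ = ∫⁻ z, ‖f z‖ₑ ^ (2 : ℝ) ∂ρ := by
    have e1 : (fun z => ‖f z‖ₑ ^ (2 : ℝ)) =ᵐ[ρ] fun z => ‖hf.mk f z‖ₑ ^ (2 : ℝ) := by
      filter_upwards [hf.ae_eq_mk] with z hz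
      rw [hz]
    have hm : Measurable fun z => ‖hf.mk f z‖ₑ ^ (2 : ℝ) :=
      (hf.stronglyMeasurable_mk.measurable.enorm).pow_const _
    rw [lintegral_congr_ae e1, ← h.iso _ hm]
    apply lintegral_congr_ae
    filter_upwards [h.qmp.ae_eq hf.ae_eq_mk] with y hy
    have hy' : f (T y) = hf.mk f (T y) := hy
    rw [enorm_mul, ENNReal.mul_rpow_of_nonneg _ _ (by norm_num), hy']
    norm_cast
  rw [eLpNorm_eq_lintegral_rpow_enorm_toReal (by norm_num) (by norm_num),
    eLpNorm_eq_lintegral_rpow_enorm_toReal (by norm_num) (by norm_num)]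
  simp only [ENNReal.toReal_ofNat]
  rw [key]

theorem IsIsometricWeight.memLp (h : IsIsometricWeight T a μ ρ) (f : Lp ℂ 2 ρ) :
    MemLp (fun y => a y * f (T y)) 2 μ := by
  refine ⟨h.meas.mul ((Lp.aestronglyMeasurable f).comp_quasiMeasurePreserving h.qmp), ?_⟩
  rw [h.eLpNorm_eq f (Lp.aestronglyMeasurable f)]
  exact Lp.eLpNorm_lt_top f

/-- The isometry `f ↦ a · (f ∘ T)` from `L²(ρ)` to `L²(μ)`. -/
def weightedComp (h : IsIsometricWeight T a μ ρ) : Lp ℂ 2 ρ →ₗᵢ[ℂ] Lp ℂ 2 μ where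
  toFun f := (h.memLp f).toLp
  map_add' f g := by
    apply Lp.ext
    filter_upwards [(h.memLp (f + g)).coeFn_toLp, (h.memLp f).coeFn_toLp, (h.memLp g).coeFn_toLp,
      Lp.coeFn_add (h.memLp f).toLp (h.memLp g).toLp, h.qmp.ae (Lp.coeFn_add f g)]
      with y h1 h2 h3 h4 h5
    rw [h1, h4, Pi.add_apply, h2, h3, h5, Pi.add_apply, mul_add]
  map_smul' c f := by
    apply Lp.ext
    filter_upwards [(h.memLp (c • f)).coeFn_toLp, (h.memLp f).coeFn_toLp,
      Lp.coeFn_smul c (h.memLp f).toLp, h.qmp.ae (Lp.coeFn_smul c f)]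
      with y h1 h2 h4 h5
    simp only [RingHom.id_apply]
    rw [h1, h4, Pi.smul_apply, h2, h5, Pi.smul_apply, smul_eq_mul, smul_eq_mul]
    ring
  norm_map' f := by
    change ‖(h.memLp f).toLp‖ = ‖f‖
    rw [Lp.norm_toLp, h.eLpNorm_eq f (Lp.aestronglyMeasurable f), Lp.norm_def]

theorem coeFn_weightedComp (h : IsIsometricWeight T a μ ρ) (f : Lp ℂ 2 ρ) :
    weightedComp h f =ᵐ[μ] fun y => a y * f (T y) :=
  (h.memLp f).coeFn_toLp

theorem isIsometricWeight_id {m : Y → ℂ} (hm : AEStronglyMeasurable m μ)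
    (h1 : ∀ᵐ y ∂μ, ‖m y‖ = 1) : IsIsometricWeight id m μ μ where
  qmp := .id μ
  meas := hm
  iso G _ := by
    apply lintegral_congr_ae
    filter_upwards [h1] with y hy
    rw [← ofReal_norm, hy]
    simp

theorem isIsometricWeight_one (hT : MeasurePreserving T μ ρ) :
    IsIsometricWeight T (fun _ => 1) μ ρ where
  qmp := hT.quasiMeasurePreserving
  meas := aestronglyMeasurable_const
  iso G hG := by simpa using hT.lintegral_comp hG

/-- The unitary operator on `L²(μ)` of multiplication by a function `m` of modulus `1`. -/
def phaseMul {m : Y → ℂ} (hm : AEStronglyMeasurable m μ) (h1 : ∀ᵐ y ∂μ, ‖m y‖ = 1) :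
    Lp ℂ 2 μ ≃ₗᵢ[ℂ] Lp ℂ 2 μ :=
  LinearIsometryEquiv.ofSurjective (weightedComp (isIsometricWeight_id hm h1)) (by
    have hm' : AEStronglyMeasurable (fun y => conj (m y)) μ :=
      Complex.continuous_conj.comp_aestronglyMeasurable hm
    have h1' : ∀ᵐ y ∂μ, ‖conj (m y)‖ = 1 := by
      filter_upwards [h1] with y hy
      simpa using hy
    intro f
    refine ⟨weightedComp (isIsometricWeight_id hm' h1') f, ?_⟩
    apply Lp.ext
    filter_upwards [coeFn_weightedComp (isIsometricWeight_id hm h1)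
        (weightedComp (isIsometricWeight_id hm' h1') f),
      coeFn_weightedComp (isIsometricWeight_id hm' h1') f, h1] with y e1 e2 e3
    rw [e1]
    simp only [id] at e2 ⊢
    rw [e2, ← mul_assoc, Complex.mul_conj, Complex.normSq_eq_norm_sq, e3]
    simp)

theorem coeFn_phaseMul {m : Y → ℂ} (hm : AEStronglyMeasurable m μ) (h1 : ∀ᵐ y ∂μ, ‖m y‖ = 1)
    (f : Lp ℂ 2 μ) : phaseMul hm h1 f =ᵐ[μ] fun y => m y * f y :=
  coeFn_weightedComp (isIsometricWeight_id hm h1) f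

end Weighted

/-- The direct sum of a family of unitary operators on a Hilbert direct sum. -/
def directSum {ι : Type*} {E : ι → Type*} [∀ i, NormedAddCommGroup (E i)]
    [∀ i, NormedSpace ℂ (E i)] (U : ∀ i, E i ≃ₗᵢ[ℂ] E i) : lp E 2 ≃ₗᵢ[ℂ] lp E 2 where
  toFun x := ⟨fun i => U i (x i),
    (memℓp_gen_iff (by norm_num)).2 (by simpa using (lp.memℓp x).summable (by norm_num))⟩
  invFun x := ⟨fun i => (U i).symm (x i),
    (memℓp_gen_iff (by norm_num)).2 (by simpa using (lp.memℓp x).summable (by norm_num))⟩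
  map_add' x y := by
    apply lp.ext
    funext i
    exact (U i).map_add (x i) (y i)
  map_smul' c x := by
    apply lp.ext
    funext i
    exact (U i).map_smul c (x i)
  left_inv x := by ext i; simp
  right_inv x := by ext i; simp
  norm_map' x := by
    rw [lp.norm_eq_tsum_rpow (by norm_num), lp.norm_eq_tsum_rpow (by norm_num)]
    simp

theorem directSum_apply {ι : Type*} {E : ι → Type*} [∀ i, NormedAddCommGroup (E i)]
    [∀ i, NormedSpace ℂ (E i)] (U : ∀ i, E i ≃ₗᵢ[ℂ] E i) (x : lp E 2) (i : ι) :
    directSum U x i = U i (x i) := rfl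

/-- The inclusion of a summand into a Hilbert direct sum. -/
def component {ι : Type*} [DecidableEq ι] {E : ι → Type*} [∀ i, NormedAddCommGroup (E i)]
    [∀ i, NormedSpace ℂ (E i)] (i : ι) : E i →ₗᵢ[ℂ] lp E 2 where
  toLinearMap := lp.lsingle 2 i
  norm_map' f := lp.norm_single (by norm_num) i f

theorem component_self {ι : Type*} [DecidableEq ι] {E : ι → Type*} [∀ i, NormedAddCommGroup (E i)]
    [∀ i, NormedSpace ℂ (E i)] (i : ι) (f : E i) : (component i f : lp E 2) i = f :=
  lp.single_apply_self 2 i f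

theorem component_ne {ι : Type*} [DecidableEq ι] {E : ι → Type*} [∀ i, NormedAddCommGroup (E i)]
    [∀ i, NormedSpace ℂ (E i)] {i k : ι} (h : k ≠ i) (f : E i) :
    (component i f : lp E 2) k = 0 :=
  lp.single_apply_ne 2 i f h

/-- The restriction of a unitary operator to a subspace that is invariant under the operator
and its inverse. -/
def restrictUnitary {H : Type*} [NormedAddCommGroup H] [NormedSpace ℂ H] (U : H ≃ₗᵢ[ℂ] H)
    (K : Submodule ℂ H) (h : ∀ x ∈ K, U x ∈ K) (h' : ∀ x ∈ K, U.symm x ∈ K) : K ≃ₗᵢ[ℂ] K where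
  toFun x := ⟨U x, h x x.2⟩
  invFun x := ⟨U.symm x, h' x x.2⟩
  map_add' x y := by ext; simp
  map_smul' c x := by ext; simp
  left_inv x := by ext; simp
  right_inv x := by ext; simp
  norm_map' x := by
    change ‖U x‖ = ‖(x : H)‖
    simp

/-! ## The two-fold Fock space of the free complex fermion, in momentum space -/

/-- A one-particle mode: a momentum together with the sign of the charge
(`true` for `+`, `false` for `-`). -/
abbrev Mode : Type := ℝ × Bool

/-- The measure `2π dp` on the half-line of positive momenta. -/
def momentumMeasure : Measure ℝ :=
  ENNReal.ofReal (2 * Real.pi) • (volume : Measure ℝ).restrict (Set.Ioi 0)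

/-- The measure for which `L²(Mode, modeMeasure)` is the fermionic one-particle space
`H₊ ⊕ H₋ = L²(ℝ₊, 2π dp) ⊕ L²(ℝ₊, 2π dq)`. -/
def modeMeasure : Measure Mode := momentumMeasure.prod Measure.count

instance : SigmaFinite momentumMeasure := by
  unfold momentumMeasure
  have : ENNReal.ofReal (2 * Real.pi) = ((2 * Real.pi).toNNReal : ℝ≥0∞) := rfl
  rw [this]
  exact inferInstanceAs (SigmaFinite ((2 * Real.pi).toNNReal • _))

instance : SigmaFinite modeMeasure := by
  unfold modeMeasure
  infer_instance

/-- Momenta and charges of `n.1` particles of the first and `n.2` particles of the second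
tensor factor. -/
abbrev Config (n : ℕ × ℕ) : Type := (Fin n.1 → Mode) × (Fin n.2 → Mode)

/-- The product measure on configurations, so that `L²(Config n)` is
`(H¹)^{⊗ n.1} ⊗ (H¹)^{⊗ n.2}`, where `H¹` is the fermionic one-particle space. -/
def configMeasure (n : ℕ × ℕ) : Measure (Config n) :=
  (Measure.pi fun _ => modeMeasure).prod (Measure.pi fun _ => modeMeasure)

instance (n : ℕ × ℕ) : SigmaFinite (configMeasure n) := by
  unfold configMeasure
  infer_instance

/-- The tensor product of two copies of the unsymmetrized Fock space over `H¹`. -/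
abbrev UnsymFock : Type := lp (fun n : ℕ × ℕ => Lp ℂ 2 (configMeasure n)) 2

/-- Permutation of the particles within each of the two factors. -/
def permConfig (n : ℕ × ℕ) (σ : Equiv.Perm (Fin n.1)) (τ : Equiv.Perm (Fin n.2))
    (z : Config n) : Config n := (z.1 ∘ σ, z.2 ∘ τ)

theorem measurePreserving_comp_perm (k : ℕ) (σ : Equiv.Perm (Fin k)) :
    MeasurePreserving (fun x : Fin k → Mode => x ∘ σ)
      (Measure.pi fun _ => modeMeasure) (Measure.pi fun _ => modeMeasure) := by
  have := measurePreserving_piCongrLeft (α := fun _ : Fin k => Mode) (fun _ => modeMeasure) σ.symm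
  convert! this using 1
  ext x i : 2
  simp [MeasurableEquiv.piCongrLeft, Equiv.piCongrLeft, Equiv.piCongrLeft']

theorem measurePreserving_permConfig (n : ℕ × ℕ) (σ : Equiv.Perm (Fin n.1))
    (τ : Equiv.Perm (Fin n.2)) :
    MeasurePreserving (permConfig n σ τ) (configMeasure n) (configMeasure n) :=
  (measurePreserving_comp_perm n.1 σ).prod (measurePreserving_comp_perm n.2 τ)

/-- The operator `f ↦ f ∘ (permutation of the particles)`. -/
def permOp (n : ℕ × ℕ) (σ : Equiv.Perm (Fin n.1)) (τ : Equiv.Perm (Fin n.2)) :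
    Lp ℂ 2 (configMeasure n) →ₗᵢ[ℂ] Lp ℂ 2 (configMeasure n) :=
  weightedComp (isIsometricWeight_one (measurePreserving_permConfig n σ τ))

/-- The tensor product of two copies of the antisymmetric Fock space over `H¹`: the vectors of the
unsymmetrized space which are antisymmetric in the particles of each of the two factors. -/
def fermiFock : Submodule ℂ UnsymFock where
  carrier := {Φ | ∀ n σ τ, permOp n σ τ (Φ n) =
    (((Equiv.Perm.sign σ : ℤ) : ℂ) * ((Equiv.Perm.sign τ : ℤ) : ℂ)) • Φ n}
  add_mem' {Φ Ψ} h1 h2 n σ τ := by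
    simp only [lp.coeFn_add, Pi.add_apply, map_add, smul_add]
    rw [h1 n σ τ, h2 n σ τ]
  zero_mem' n σ τ := by simp
  smul_mem' c Φ h n σ τ := by
    simp only [lp.coeFn_smul, Pi.smul_apply, map_smul]
    rw [h n σ τ, smul_comm]

/-- The unitary operator on the unsymmetrized space which multiplies the `n`-component by the
function `m n` of modulus `1`. -/
def phaseOp (m : ∀ n, Config n → ℂ) (hm : ∀ n, AEStronglyMeasurable (m n) (configMeasure n))
    (h1 : ∀ n, ∀ᵐ z ∂configMeasure n, ‖m n z‖ = 1) : UnsymFock ≃ₗᵢ[ℂ] UnsymFock :=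
  directSum fun n => phaseMul (hm n) (h1 n)

theorem permOp_phaseMul {n : ℕ × ℕ} {m : Config n → ℂ}
    (hm : AEStronglyMeasurable m (configMeasure n))
    (h1 : ∀ᵐ z ∂configMeasure n, ‖m z‖ = 1) (σ : Equiv.Perm (Fin n.1)) (τ : Equiv.Perm (Fin n.2))
    (hinv : ∀ z, m (permConfig n σ τ z) = m z) (f : Lp ℂ 2 (configMeasure n)) :
    permOp n σ τ (phaseMul hm h1 f) = phaseMul hm h1 (permOp n σ τ f) := by
  have hP := measurePreserving_permConfig n σ τ
  apply Lp.ext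
  filter_upwards [coeFn_weightedComp (isIsometricWeight_one hP) (phaseMul hm h1 f),
    hP.quasiMeasurePreserving.ae (coeFn_phaseMul hm h1 f),
    coeFn_phaseMul hm h1 (permOp n σ τ f),
    coeFn_weightedComp (isIsometricWeight_one hP) f] with z e1 e2 e3 e4
  rw [e3]
  change (weightedComp (isIsometricWeight_one hP) (phaseMul hm h1 f)) z =
    m z * (weightedComp (isIsometricWeight_one hP) f) z
  rw [e1, e4, e2, hinv]
  ring

theorem phaseOp_mem {m : ∀ n, Config n → ℂ}
    (hm : ∀ n, AEStronglyMeasurable (m n) (configMeasure n))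
    (h1 : ∀ n, ∀ᵐ z ∂configMeasure n, ‖m n z‖ = 1)
    (hinv : ∀ n σ τ z, m n (permConfig n σ τ z) = m n z) :
    (∀ Φ ∈ fermiFock, phaseOp m hm h1 Φ ∈ fermiFock) ∧
      ∀ Φ ∈ fermiFock, (phaseOp m hm h1).symm Φ ∈ fermiFock := by
  constructor
  · intro Φ hΦ n σ τ
    change permOp n σ τ (phaseMul (hm n) (h1 n) (Φ n)) = _ • phaseMul (hm n) (h1 n) (Φ n)
    rw [permOp_phaseMul _ _ _ _ (hinv n σ τ), hΦ n σ τ, map_smul]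
  · intro Φ hΦ n σ τ
    change permOp n σ τ ((phaseMul (hm n) (h1 n)).symm (Φ n)) =
      _ • (phaseMul (hm n) (h1 n)).symm (Φ n)
    apply (phaseMul (hm n) (h1 n)).injective
    rw [← permOp_phaseMul _ _ _ _ (hinv n σ τ), map_smul]
    simpa using hΦ n σ τ

/-- The restriction of `phaseOp` to the antisymmetric space, for permutation invariant phases. -/
def fermiPhaseOp (m : ∀ n, Config n → ℂ)
    (hm : ∀ n, AEStronglyMeasurable (m n) (configMeasure n))
    (h1 : ∀ n, ∀ᵐ z ∂configMeasure n, ‖m n z‖ = 1)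
    (hinv : ∀ n σ τ z, m n (permConfig n σ τ z) = m n z) : fermiFock ≃ₗᵢ[ℂ] fermiFock :=
  restrictUnitary (phaseOp m hm h1) fermiFock (phaseOp_mem hm h1 hinv).1 (phaseOp_mem hm h1 hinv).2

/-! ## The scattering operator -/

/-- The function by which `M_φ = φ(P₊ ⊗ P₊) ⊕ φˇ(P₊ ⊗ P₋) ⊕ φˇ(P₋ ⊗ P₊) ⊕ φ(P₋ ⊗ P₋)` multiplies,
where `φˇ = check φ`. -/
def twoParticlePhase (φ : ℝ → ℂ) (w : Mode × Mode) : ℂ :=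
  if w.1.2 = w.2.2 then φ (w.1.1 * w.2.1) else check φ (w.1.1 * w.2.1)

/-- The function by which `∏_{i,j} (M_φ)_{i,j}` multiplies, where `(M_φ)_{i,j}` acts as `M_φ` on the
`i`-th particle of the first and the `j`-th particle of the second factor. -/
def scatteringPhase (φ : ℝ → ℂ) (n : ℕ × ℕ) (z : Config n) : ℂ :=
  ∏ i, ∏ j, twoParticlePhase φ (z.1 i, z.2 j)

theorem scatteringPhase_perm (φ : ℝ → ℂ) (n : ℕ × ℕ) (σ : Equiv.Perm (Fin n.1))
    (τ : Equiv.Perm (Fin n.2)) (z : Config n) :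
    scatteringPhase φ n (permConfig n σ τ z) = scatteringPhase φ n z := by
  unfold scatteringPhase permConfig
  simp only [Function.comp_apply]
  rw [Equiv.prod_comp σ (fun i => ∏ j, twoParticlePhase φ (z.1 i, z.2 (τ j)))]
  exact Finset.prod_congr rfl fun i _ =>
    Equiv.prod_comp τ (fun j => twoParticlePhase φ (z.1 i, z.2 j))

theorem IsInnerFunction.aestronglyMeasurable {φ : ℝ → ℂ} (h : IsInnerFunction φ) :
    AEStronglyMeasurable φ volume := by
  obtain ⟨F, hF, -, hlim⟩ := h
  refine aestronglyMeasurable_of_tendsto_ae Filter.atTop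
    (f := fun (k : ℕ) (x : ℝ) => F (x + ((1 / ((k : ℝ) + 1) : ℝ) : ℂ) * Complex.I)) ?_ ?_
  · intro k
    apply Continuous.aestronglyMeasurable
    refine hF.continuousOn.comp_continuous (by fun_prop) fun x => ?_
    have : (0 : ℝ) < 1 / ((k : ℝ) + 1) := by positivity
    change 0 < ((x : ℂ) + ((1 / ((k : ℝ) + 1) : ℝ) : ℂ) * Complex.I).im
    rw [Complex.add_im, Complex.ofReal_im, zero_add, Complex.im_ofReal_mul, Complex.I_im, mul_one]
    exact this
  · filter_upwards [hlim] with x hx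
    refine hx.1.comp (tendsto_nhdsWithin_iff.2 ⟨tendsto_one_div_add_atTop_nhds_zero_nat, ?_⟩)
    exact Filter.Eventually.of_forall fun k => by
      have : (0 : ℝ) < 1 / ((k : ℝ) + 1) := by positivity
      exact this

theorem IsInnerFunction.norm_eq_one {φ : ℝ → ℂ} (h : IsInnerFunction φ) :
    ∀ᵐ x : ℝ, ‖φ x‖ = 1 := by
  obtain ⟨F, -, -, hlim⟩ := h
  exact hlim.mono fun x hx => hx.2

theorem momentumMeasure_absolutelyContinuous : momentumMeasure ≪ volume :=
  Measure.restrict_le_self.absolutelyContinuous.smul_left _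

theorem ae_momentumMeasure_pos : ∀ᵐ p ∂momentumMeasure, 0 < p := by
  unfold momentumMeasure
  exact Measure.ae_smul_measure (ae_restrict_mem measurableSet_Ioi) _

theorem quasiMeasurePreserving_mul : Measure.QuasiMeasurePreserving
    (fun w : Mode × Mode => w.1.1 * w.2.1) (modeMeasure.prod modeMeasure) volume := by
  have h0 : Measure.QuasiMeasurePreserving (fun w : ℝ × ℝ => w.1 * w.2)
      (momentumMeasure.prod momentumMeasure) volume := by
    refine QuasiMeasurePreserving.prod_of_right (by fun_prop) ?_
    filter_upwards [ae_momentumMeasure_pos] with p hp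
    refine Measure.QuasiMeasurePreserving.mono_left (μa := volume) ⟨by fun_prop, ?_⟩
      momentumMeasure_absolutelyContinuous
    refine Measure.AbsolutelyContinuous.mk fun s hs h2 => ?_
    rw [Measure.map_apply (by fun_prop) hs, Real.volume_preimage_mul_left hp.ne', h2, mul_zero]
  exact h0.comp (QuasiMeasurePreserving.prodMap Measure.quasiMeasurePreserving_fst
    Measure.quasiMeasurePreserving_fst)

theorem twoParticlePhase_aux {φ : ℝ → ℂ} (h : IsInnerFunction φ) :
    AEStronglyMeasurable (twoParticlePhase φ) (modeMeasure.prod modeMeasure) ∧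
      ∀ᵐ w ∂modeMeasure.prod modeMeasure, ‖twoParticlePhase φ w‖ = 1 := by
  have q := quasiMeasurePreserving_mul
  have hneg : Measure.QuasiMeasurePreserving (fun x : ℝ => -x) volume volume :=
    (Measure.measurePreserving_neg (volume : Measure ℝ)).quasiMeasurePreserving
  constructor
  · have hφ := h.aestronglyMeasurable
    have hc : Measurable (check (hφ.mk φ)) :=
      Complex.continuous_conj.measurable.comp
        (hφ.stronglyMeasurable_mk.measurable.comp measurable_neg)
    refine ⟨twoParticlePhase (hφ.mk φ), ?_, ?_⟩
    · apply Measurable.stronglyMeasurable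
      unfold twoParticlePhase
      exact Measurable.ite
        (measurableSet_eq_fun (by fun_prop) (by fun_prop))
        (hφ.stronglyMeasurable_mk.measurable.comp (by fun_prop)) (hc.comp (by fun_prop))
    · filter_upwards [q.ae hφ.ae_eq_mk, (hneg.comp q).ae hφ.ae_eq_mk] with w h1 h2
      simp only [Function.comp_apply] at h2
      simp only [twoParticlePhase, check, h1, h2]
  · filter_upwards [q.ae h.norm_eq_one, (hneg.comp q).ae h.norm_eq_one] with w h1 h2
    simp only [Function.comp_apply] at h2
    unfold twoParticlePhase check
    split_ifs
    · exact h1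
    · rw [RCLike.norm_conj, h2]

theorem quasiMeasurePreserving_pair (n : ℕ × ℕ) (i : Fin n.1) (j : Fin n.2) :
    Measure.QuasiMeasurePreserving (fun z : Config n => (z.1 i, z.2 j)) (configMeasure n)
      (modeMeasure.prod modeMeasure) :=
  QuasiMeasurePreserving.prodMap (Measure.quasiMeasurePreserving_eval (fun _ => modeMeasure) i)
    (Measure.quasiMeasurePreserving_eval (fun _ => modeMeasure) j)

theorem scatteringPhase_meas {φ : ℝ → ℂ} (h : IsInnerFunction φ) (n : ℕ × ℕ) :
    AEStronglyMeasurable (scatteringPhase φ n) (configMeasure n) := by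
  unfold scatteringPhase
  refine Finset.aestronglyMeasurable_fun_prod _ fun i _ =>
    Finset.aestronglyMeasurable_fun_prod _ fun j _ => ?_
  exact (twoParticlePhase_aux h).1.comp_quasiMeasurePreserving (quasiMeasurePreserving_pair n i j)

theorem scatteringPhase_norm {φ : ℝ → ℂ} (h : IsInnerFunction φ) (n : ℕ × ℕ) :
    ∀ᵐ z ∂configMeasure n, ‖scatteringPhase φ n z‖ = 1 := by
  have : ∀ᵐ z ∂configMeasure n, ∀ i j, ‖twoParticlePhase φ (z.1 i, z.2 j)‖ = 1 := by
    rw [ae_all_iff]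
    intro i
    rw [ae_all_iff]
    intro j
    exact (quasiMeasurePreserving_pair n i j).ae (twoParticlePhase_aux h).2
  filter_upwards [this] with z hz
  simp [scatteringPhase, norm_prod, hz]

/-- The unitary operator `S_φ = ⨁_{m,n} ∏_{i,j} (M_φ)_{i,j}` on the tensor product of two
fermionic Fock spaces. -/
def scatteringOperator (φ : ℝ → ℂ) (hφ : IsInnerFunction φ) : fermiFock ≃ₗᵢ[ℂ] fermiFock :=
  fermiPhaseOp (scatteringPhase φ) (scatteringPhase_meas hφ) (scatteringPhase_norm hφ)
    (scatteringPhase_perm φ)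

/-! ## The gauge action and the bosonic subspace -/

/-- The phase of a mode under the gauge rotation by the angle `θ`. -/
def modePhase (θ : ℝ) (x : Mode) : ℂ :=
  Complex.exp (Complex.I * ((if x.2 then θ else -θ : ℝ) : ℂ))

/-- The function by which `V(θ) ⊗ V(θ')` multiplies. -/
def gaugePhase (θ θ' : ℝ) (n : ℕ × ℕ) (z : Config n) : ℂ :=
  (∏ i, modePhase θ (z.1 i)) * ∏ j, modePhase θ' (z.2 j)

theorem gaugePhase_perm (θ θ' : ℝ) (n : ℕ × ℕ) (σ : Equiv.Perm (Fin n.1))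
    (τ : Equiv.Perm (Fin n.2)) (z : Config n) :
    gaugePhase θ θ' n (permConfig n σ τ z) = gaugePhase θ θ' n z := by
  unfold gaugePhase permConfig
  simp only [Function.comp_apply]
  rw [Equiv.prod_comp σ (fun i => modePhase θ (z.1 i)),
    Equiv.prod_comp τ (fun j => modePhase θ' (z.2 j))]

theorem measurable_modePhase (θ : ℝ) : Measurable (modePhase θ) := by
  have h : Measurable fun b : Bool => Complex.exp (Complex.I * ((if b then θ else -θ : ℝ) : ℂ)) :=
    measurable_from_top
  exact h.comp measurable_snd

theorem gaugePhase_meas (θ θ' : ℝ) (n : ℕ × ℕ) :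
    AEStronglyMeasurable (gaugePhase θ θ' n) (configMeasure n) := by
  apply Measurable.aestronglyMeasurable
  unfold gaugePhase
  refine Measurable.mul (Finset.measurable_fun_prod _ fun i _ => ?_)
    (Finset.measurable_fun_prod _ fun j _ => ?_)
  · exact (measurable_modePhase θ).comp (by fun_prop)
  · exact (measurable_modePhase θ').comp (by fun_prop)

theorem gaugePhase_norm (θ θ' : ℝ) (n : ℕ × ℕ) :
    ∀ᵐ z ∂configMeasure n, ‖gaugePhase θ θ' n z‖ = 1 := by
  refine Filter.Eventually.of_forall fun z => ?_
  have h : ∀ t x, ‖modePhase t x‖ = 1 := fun t x => by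
    unfold modePhase
    rw [mul_comm, Complex.norm_exp_ofReal_mul_I]
  simp [gaugePhase, norm_prod, h]

/-- The gauge unitary `V(θ) ⊗ V(θ')`. -/
def gaugeOperator (θ θ' : ℝ) : fermiFock ≃ₗᵢ[ℂ] fermiFock :=
  fermiPhaseOp (gaugePhase θ θ') (gaugePhase_meas θ θ') (gaugePhase_norm θ θ')
    (gaugePhase_perm θ θ')

/-- The vectors invariant under all `V(θ) ⊗ V(θ')`, that is, the vectors of charge zero in both
factors. Under the identification of the `U(1)`-current net with the gauge-invariant part of the
complex fermion net, this is the tensor product of two bosonic Fock spaces. -/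
def bosonFock : Submodule ℂ fermiFock where
  carrier := {Φ | ∀ θ θ', gaugeOperator θ θ' Φ = Φ}
  add_mem' {Φ Ψ} h1 h2 θ θ' := by rw [map_add, h1, h2]
  zero_mem' θ θ' := by simp
  smul_mem' c Φ h θ θ' := by rw [map_smul, h]

/-! ## The bosonic `1+1` particle space -/

/-- The measure `p dp` on the half-line; `L²(bosonMeasure)` is the bosonic one-particle space. -/
def bosonMeasure : Measure ℝ :=
  ((volume : Measure ℝ).restrict (Set.Ioi 0)).withDensity fun p => ENNReal.ofReal p

instance : SigmaFinite bosonMeasure := by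
  unfold bosonMeasure
  exact SigmaFinite.withDensity_ofReal _

/-- The bosonic `1+1` particle space `L²(ℝ₊, p dp) ⊗ L²(ℝ₊, p dp)`. -/
abbrev BosonOneOne : Type := Lp ℂ 2 (bosonMeasure.prod bosonMeasure)

/-- The sign of an ordered pair of charges: it is `1` for `(+,-)`, `-1` for `(-,+)`, and `0` for
equal charges. -/
def chargeSign (s t : Bool) : ℂ := if s = t then 0 else if s then 1 else -1

/-- A wave function `f(p,q)` of one particle of charge `+` with momentum `p` and one of charge `-`
with momentum `q` is, as an antisymmetric function of two modes, `2^{-1/2} chargeSign` times `f`.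
With the normalization `1/2π` of the embedding of the bosonic one-particle space, this gives the
weight. -/
def pairWeight (x : Fin 2 → Mode) : ℂ :=
  ((1 / (√2 * (2 * Real.pi)) : ℝ) : ℂ) * chargeSign (x 0).2 (x 1).2

/-- The total momentum of a pair of modes. -/
def pairMomentum (x : Fin 2 → Mode) : ℝ := (x 0).1 + (x 1).1

theorem lintegral_add_halfLine (G : ℝ → ℝ≥0∞) (hG : Measurable G) :
    ∫⁻ p in Set.Ioi (0 : ℝ), ∫⁻ q in Set.Ioi (0 : ℝ), G (p + q) = ∫⁻ s, G s ∂bosonMeasure := by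
  have h1 : ∀ p : ℝ, ∫⁻ q in Set.Ioi (0 : ℝ), G (p + q) =
      ∫⁻ s, (Set.Ioi (0 : ℝ)).indicator (fun _ => (1 : ℝ≥0∞)) (s - p) * G s := by
    intro p
    rw [← lintegral_indicator measurableSet_Ioi,
      ← lintegral_add_left_eq_self (μ := (volume : Measure ℝ))
        (fun s => (Set.Ioi (0 : ℝ)).indicator (fun _ => (1 : ℝ≥0∞)) (s - p) * G s) p]
    refine lintegral_congr fun q => ?_
    by_cases hq : 0 < q <;> simp [Set.indicator, hq]
  have hm : Measurable fun z : ℝ × ℝ =>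
      (Set.Ioi (0 : ℝ)).indicator (fun _ => (1 : ℝ≥0∞)) (z.2 - z.1) * G z.2 :=
    ((measurable_const.indicator measurableSet_Ioi).comp
      (measurable_snd.sub measurable_fst)).mul (hG.comp measurable_snd)
  simp_rw [h1]
  rw [lintegral_lintegral_swap hm.aemeasurable]
  unfold bosonMeasure
  rw [lintegral_withDensity_eq_lintegral_mul _ (by fun_prop) hG,
    ← lintegral_indicator measurableSet_Ioi]
  refine lintegral_congr fun s => ?_
  have hm' : Measurable fun p : ℝ => (Set.Ioi (0 : ℝ)).indicator (fun _ => (1 : ℝ≥0∞)) (s - p) :=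
    (measurable_const.indicator measurableSet_Ioi).comp (measurable_const.sub measurable_id)
  rw [lintegral_mul_const _ hm', ← lintegral_indicator measurableSet_Ioi]
  have h2 : (fun p : ℝ => (Set.Ioi (0 : ℝ)).indicator
      (fun p => (Set.Ioi (0 : ℝ)).indicator (fun _ => (1 : ℝ≥0∞)) (s - p)) p) =
      (Set.Ioo 0 s).indicator fun _ => 1 := by
    funext p
    by_cases hp : 0 < p <;> by_cases hs : p < s <;> simp [Set.indicator, hp, hs]
  rw [h2, lintegral_indicator measurableSet_Ioo]
  by_cases hs : 0 < s
  · simp [Set.indicator, hs]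
  · simp [Set.indicator, hs, Set.Ioo_eq_empty]

theorem lintegral_pair (w : Bool → Bool → ℝ≥0∞) (G : ℝ → ℝ≥0∞) (hG : Measurable G) :
    ∫⁻ x : Fin 2 → Mode, w (x 0).2 (x 1).2 * G (pairMomentum x) ∂Measure.pi (fun _ => modeMeasure) =
      (∑ s, ∑ t, w s t) * (ENNReal.ofReal (2 * Real.pi) ^ 2 * ∫⁻ z, G z ∂bosonMeasure) := by
  have hw : Measurable fun b : Bool × Bool => w b.1 b.2 := measurable_of_finite _
  have hone : ∀ H : Mode → ℝ≥0∞, Measurable H → ∫⁻ x, H x ∂modeMeasure =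
      ENNReal.ofReal (2 * Real.pi) * ∫⁻ p in Set.Ioi (0 : ℝ), ∑ s, H (p, s) := by
    intro H hH
    unfold modeMeasure momentumMeasure
    rw [lintegral_prod _ hH.aemeasurable]
    simp only [lintegral_count, tsum_fintype, lintegral_smul_measure, smul_eq_mul]
  have hm : Measurable fun x : Mode × Mode => w x.1.2 x.2.2 * G (x.1.1 + x.2.1) :=
    (hw.comp (by fun_prop : Measurable fun x : Mode × Mode => (x.1.2, x.2.2))).mul
      (hG.comp (by fun_prop))
  have h2 := (measurePreserving_finTwoArrow modeMeasure).lintegral_comp hm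
  have h3 : ∫⁻ x : Fin 2 → Mode, w (x 0).2 (x 1).2 * G (pairMomentum x)
      ∂Measure.pi (fun _ => modeMeasure) =
      ∫⁻ z, w z.1.2 z.2.2 * G (z.1.1 + z.2.1) ∂modeMeasure.prod modeMeasure := h2
  rw [h3, lintegral_prod _ hm.aemeasurable, hone _ hm.lintegral_prod_right']
  have h4 : ∀ p s, ∫⁻ y, w s y.2 * G (p + y.1) ∂modeMeasure =
      (∑ t, w s t) * (ENNReal.ofReal (2 * Real.pi) * ∫⁻ q in Set.Ioi (0 : ℝ), G (p + q)) := by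
    intro p s
    have hm' : Measurable fun y : Mode => w s y.2 * G (p + y.1) :=
      hm.comp (measurable_prodMk_left (x := ((p, s) : Mode)))
    rw [hone _ hm']
    simp only [← Finset.sum_mul]
    have hGp : Measurable fun q : ℝ => G (p + q) := hG.comp (by fun_prop)
    rw [lintegral_const_mul _ hGp]
    ring
  simp only [h4, ← Finset.sum_mul]
  have hmI : Measurable fun p : ℝ => ∫⁻ q in Set.Ioi (0 : ℝ), G (p + q) :=
    (hG.comp (by fun_prop : Measurable fun z : ℝ × ℝ => z.1 + z.2)).lintegral_prod_right'
  rw [lintegral_const_mul _ (hmI.const_mul _), lintegral_const_mul _ hmI,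
    lintegral_add_halfLine G hG]
  ring

theorem measurable_pairMomentum : Measurable pairMomentum := by
  unfold pairMomentum
  fun_prop

theorem measurable_pairWeight : Measurable pairWeight := by
  have h : Measurable fun b : Bool × Bool => chargeSign b.1 b.2 := measurable_of_finite _
  exact (h.comp (by fun_prop : Measurable fun x : Fin 2 → Mode => ((x 0).2, (x 1).2))).const_mul _

theorem isIsometricWeight_pair : IsIsometricWeight pairMomentum pairWeight
    (Measure.pi fun _ => modeMeasure) bosonMeasure where
  qmp := by
    refine ⟨measurable_pairMomentum, Measure.AbsolutelyContinuous.mk fun s hs h0 => ?_⟩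
    have h := lintegral_pair (fun _ _ => 1) (s.indicator fun _ => 1)
      (measurable_const.indicator hs)
    simp only [one_mul] at h
    rw [lintegral_indicator hs, setLIntegral_one, h0, mul_zero, mul_zero] at h
    rw [Measure.map_apply measurable_pairMomentum hs, ← setLIntegral_one,
      ← lintegral_indicator (measurable_pairMomentum hs), ← h]
    rfl
  meas := measurable_pairWeight.aestronglyMeasurable
  iso G hG := by
    have h := lintegral_pair
      (fun s t => ‖((1 / (√2 * (2 * Real.pi)) : ℝ) : ℂ) * chargeSign s t‖ₑ ^ 2) G hG
    have hpi := Real.pi_pos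
    have hc : ‖((1 / (√2 * (2 * Real.pi)) : ℝ) : ℂ)‖ₑ ^ 2 =
        ENNReal.ofReal (1 / (2 * (2 * Real.pi) ^ 2)) := by
      rw [← ofReal_norm, Complex.norm_real, Real.norm_of_nonneg (by positivity),
        ← ENNReal.ofReal_pow (by positivity)]
      congr 1
      rw [div_pow, mul_pow, Real.sq_sqrt (by norm_num), one_pow]
    have hsum : ∑ s, ∑ t, ‖((1 / (√2 * (2 * Real.pi)) : ℝ) : ℂ) * chargeSign s t‖ₑ ^ 2 =
        ENNReal.ofReal (2 * (1 / (2 * (2 * Real.pi) ^ 2))) := by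
      simp only [enorm_mul, mul_pow, hc, Fintype.sum_bool, chargeSign]
      rw [ENNReal.ofReal_mul (by norm_num)]
      simp [two_mul]
    refine h.trans ?_
    rw [hsum, ← mul_assoc, ← ENNReal.ofReal_pow (by positivity),
      ← ENNReal.ofReal_mul (by positivity)]
    have : 2 * (1 / (2 * (2 * Real.pi) ^ 2)) * (2 * Real.pi) ^ 2 = 1 := by
      field_simp
    rw [this, ENNReal.ofReal_one, one_mul]

theorem IsIsometricWeight.prod {Y Z Y' Z' : Type*} [MeasurableSpace Y] [MeasurableSpace Z]
    [MeasurableSpace Y'] [MeasurableSpace Z'] {T : Y → Z} {a : Y → ℂ} {μ : Measure Y}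
    {ρ : Measure Z} {T' : Y' → Z'} {a' : Y' → ℂ} {μ' : Measure Y'} {ρ' : Measure Z'}
    [SFinite μ] [SFinite μ'] [SFinite ρ] [SFinite ρ']
    (ha : Measurable a) (ha' : Measurable a')
    (h : IsIsometricWeight T a μ ρ) (h' : IsIsometricWeight T' a' μ' ρ') :
    IsIsometricWeight (Prod.map T T') (fun y => a y.1 * a' y.2) (μ.prod μ') (ρ.prod ρ') where
  qmp := QuasiMeasurePreserving.prodMap h.qmp h'.qmp
  meas := ((ha.comp measurable_fst).mul (ha'.comp measurable_snd)).aestronglyMeasurable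
  iso G hG := by
    have hT := h.qmp.measurable
    have hT' := h'.qmp.measurable
    have hm : Measurable fun y : Y × Y' =>
        ‖a y.1 * a' y.2‖ₑ ^ 2 * G (Prod.map T T' y) :=
      (((ha.comp measurable_fst).mul (ha'.comp measurable_snd)).enorm.pow_const 2).mul
        (hG.comp (hT.prodMap hT'))
    rw [lintegral_prod _ hm.aemeasurable, lintegral_prod _ hG.aemeasurable,
      ← h.iso _ hG.lintegral_prod_right']
    refine lintegral_congr fun y => ?_
    rw [← h'.iso (fun z => G (T y, z)) (hG.comp measurable_prodMk_left), ← lintegral_const_mul]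
    · refine lintegral_congr fun y' => ?_
      simp only [enorm_mul, mul_pow, Prod.map_apply, mul_assoc]
    · exact (ha'.enorm.pow_const 2).mul ((hG.comp measurable_prodMk_left).comp hT')

/-- The weight and the map defining the embedding
`Ψ ↦ (2π)⁻² Ψ(p + q, p' + q')` of the bosonic `1+1` particle space. -/
theorem isIsometricWeight_boson : IsIsometricWeight
    (Prod.map pairMomentum pairMomentum) (fun z : Config (2, 2) => pairWeight z.1 * pairWeight z.2)
    (configMeasure (2, 2)) (bosonMeasure.prod bosonMeasure) :=
  isIsometricWeight_pair.prod measurable_pairWeight measurable_pairWeight isIsometricWeight_pair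

/-- The embedding into the unsymmetrized space, with values in the component with two particles
in each factor. -/
def bosonEmbeddingUnsym : BosonOneOne →ₗᵢ[ℂ] UnsymFock :=
  (component ((2, 2) : ℕ × ℕ)).comp (weightedComp isIsometricWeight_boson)

theorem pairMomentum_perm (σ : Equiv.Perm (Fin 2)) (x : Fin 2 → Mode) :
    pairMomentum (x ∘ σ) = pairMomentum x := by
  unfold pairMomentum
  have := Equiv.sum_comp σ (fun i => (x i).1)
  simpa [Fin.sum_univ_two] using this

theorem pairWeight_perm (σ : Equiv.Perm (Fin 2)) (x : Fin 2 → Mode) :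
    pairWeight (x ∘ σ) = ((Equiv.Perm.sign σ : ℤ) : ℂ) * pairWeight x := by
  have hσ : σ = 1 ∨ σ = Equiv.swap 0 1 := by
    revert σ
    decide
  rcases hσ with rfl | rfl
  · simp
  · have h01 : (0 : Fin 2) ≠ 1 := by decide
    rw [Equiv.Perm.sign_swap h01]
    unfold pairWeight
    simp only [Function.comp_apply, Equiv.swap_apply_left, Equiv.swap_apply_right]
    rcases x 0 with ⟨p, _ | _⟩ <;> rcases x 1 with ⟨q, _ | _⟩ <;> simp [chargeSign]

theorem bosonEmbeddingUnsym_mem (Ψ : BosonOneOne) : bosonEmbeddingUnsym Ψ ∈ fermiFock := by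
  intro n σ τ
  change permOp n σ τ
      ((component ((2, 2) : ℕ × ℕ) (weightedComp isIsometricWeight_boson Ψ) : UnsymFock) n) =
    _ • (component ((2, 2) : ℕ × ℕ) (weightedComp isIsometricWeight_boson Ψ) : UnsymFock) n
  by_cases hn : n = (2, 2)
  · subst hn
    rw [component_self]
    have hP := measurePreserving_permConfig (2, 2) σ τ
    have hB := coeFn_weightedComp isIsometricWeight_boson Ψ
    apply Lp.ext
    filter_upwards [coeFn_weightedComp (isIsometricWeight_one hP)
        (weightedComp isIsometricWeight_boson Ψ), hB, hP.quasiMeasurePreserving.ae hB,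
      Lp.coeFn_smul (((Equiv.Perm.sign σ : ℤ) : ℂ) * ((Equiv.Perm.sign τ : ℤ) : ℂ))
        (weightedComp isIsometricWeight_boson Ψ)] with z e1 e2 e3 e4
    rw [e4, Pi.smul_apply, e2]
    refine e1.trans ?_
    rw [e3]
    simp only [permConfig, Prod.map, pairMomentum_perm, pairWeight_perm, smul_eq_mul]
    ring
  · rw [component_ne hn, map_zero, smul_zero]

/-- The isometric embedding of the bosonic `1+1` particle space: the wave function of `ι Ψ` is
`(2π)⁻² Ψ(p + q, p' + q')`, where `p, q` are the momenta of one particle of charge `+` and one of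
charge `-` in the first factor, and `p', q'` those in the second factor. -/
def bosonEmbedding : BosonOneOne →ₗᵢ[ℂ] fermiFock where
  toLinearMap := bosonEmbeddingUnsym.toLinearMap.codRestrict fermiFock bosonEmbeddingUnsym_mem
  norm_map' Ψ := bosonEmbeddingUnsym.norm_map Ψ

/-- The bosonic `1+1` particle space as a subspace of the tensor product of the two fermionic
Fock spaces. -/
def oneOneParticleSpace : Submodule ℂ fermiFock :=
  LinearMap.range bosonEmbedding.toLinearMap

end FermiScattering

end

open FermiScattering

/-! On two pairs of opposite charges, with momenta `p, q` in the first factor and `a, b` in the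
second, `S_φ` multiplies by φ(pa) φˇ(pb) φˇ(qa) φ(qb), while wave functions from the bosonic `1+1`
particle space depend on `p + q` and `a + b` only. Applied to an image vector with almost everywhere
non-zero profile, invariance of the space forces this phase to be a function of the total momenta.
For exponentials it is: the constants `θ` cancel and the exponents add up to `κ (p + q)(a + b)`.

For the converse, put `p = t x`, `q = t (1 - x)`. With `x, a, b` fixed, the phase is the boundary
value in `t` of a bounded holomorphic function on the upper half-plane, built from the extension `F`
of `φ` and its reflection. The charge order `(+,-)` gives independence of `x` for `t > 0`, the order
`(-,+)` for `t < 0`, so no symmetry of `φ` is needed. Uniqueness of boundary values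
(`eq_zero_of_boundary_zero`) moves the relation to `t = i`, where it becomes a functional equation
for the smooth function `f x = F (i x)` (`isSumInvariant_of_ae`).

A zero of `f` would spread and force `F = 0`. Otherwise the logarithmic derivative of `f` is `-κ + i
e / x` (`IsSumInvariant.exists_deriv_eq`), so `F z = C exp (i κ z + i e log (-i z))`. On the two
real half-lines this has moduli `|C| exp (± e π / 2)`; both are `1`, whence `e = 0` and `|C| = 1`.

Mixing follows by orthogonal projection onto the closed `1+1` particle space, since `S_φ` commutes
with the gauge action. -/

namespace FermiScattering

/-! ### Uniqueness of boundary values on the upper half-plane -/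

/-- A horizontal line in the upper half-plane can be moved without changing the integral of a
holomorphic function with quadratic decay. -/
theorem integral_horizontal_eq {g : ℂ → ℂ} (hg : DifferentiableOn ℂ g {z | 0 < z.im})
    {B y₁ y₂ : ℝ} (h1 : 0 < y₁) (h12 : y₁ ≤ y₂)
    (hb : ∀ x : ℝ, ∀ y ∈ Set.Icc y₁ y₂, ‖g (x + y * Complex.I)‖ ≤ B * (1 + x ^ 2)⁻¹) :
    ∫ x : ℝ, g (x + y₁ * Complex.I) = ∫ x : ℝ, g (x + y₂ * Complex.I) := by
  have hint : ∀ y ∈ Set.Icc y₁ y₂, Integrable fun x : ℝ => g (x + y * Complex.I) := by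
    intro y hy
    refine (integrable_inv_one_add_sq.const_mul B).mono' ?_
      (Filter.Eventually.of_forall fun x => hb x y hy)
    apply Continuous.aestronglyMeasurable
    refine hg.continuousOn.comp_continuous (by fun_prop) fun x => ?_
    simpa using h1.trans_le hy.1
  -- The vertical sides of the rectangles, at real part `s * R` with `s = ±1`, contribute nothing in
  -- the limit.
  have hside : ∀ (s : ℝ), |s| = 1 → Filter.Tendsto
      (fun R : ℝ => ∫ y in y₁..y₂, g ((s * R : ℝ) + y * Complex.I)) Filter.atTop (𝓝 0) := by
    intro s hs
    have hs2 : s ^ 2 = 1 := by rw [← sq_abs, hs]; norm_num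
    have hlim : Filter.Tendsto (fun R : ℝ => B * (1 + R ^ 2)⁻¹ * |y₂ - y₁|) Filter.atTop (𝓝 0) := by
      have : Filter.Tendsto (fun R : ℝ => (1 + R ^ 2)⁻¹) Filter.atTop (𝓝 0) :=
        tendsto_inv_atTop_zero.comp
          (Filter.tendsto_atTop_add_const_left _ _ (Filter.tendsto_pow_atTop (by norm_num)))
      simpa using (this.const_mul B).mul_const |y₂ - y₁|
    refine squeeze_zero_norm (fun R => ?_) hlim
    refine intervalIntegral.norm_integral_le_of_norm_le_const fun y hy => ?_
    rw [Set.uIoc_of_le h12] at hy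
    have := hb (s * R) y ⟨hy.1.le, hy.2⟩
    rwa [mul_pow, hs2, one_mul] at this
  have hrect : ∀ R : ℝ, (∫ x in (-R)..R, g (x + y₁ * Complex.I)) -
      (∫ x in (-R)..R, g (x + y₂ * Complex.I)) +
      Complex.I * (∫ y in y₁..y₂, g ((1 * R : ℝ) + y * Complex.I)) -
      Complex.I * (∫ y in y₁..y₂, g ((-1 * R : ℝ) + y * Complex.I)) = 0 := by
    intro R
    have := Complex.integral_boundary_rect_eq_zero_of_differentiableOn g
      (-R + y₁ * Complex.I) (R + y₂ * Complex.I) (hg.mono ?_)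
    · simpa using this
    · intro z hz
      have h2 := hz.2
      simp only [Set.mem_preimage, Complex.add_im, Complex.neg_im, Complex.ofReal_im,
        Complex.mul_im, Complex.ofReal_re, Complex.I_im, Complex.I_re, mul_one, mul_zero, add_zero,
        neg_zero, zero_add, Set.uIcc_of_le h12] at h2
      exact h1.trans_le h2.1
  have hl : ∀ y ∈ Set.Icc y₁ y₂, Filter.Tendsto
      (fun R : ℝ => ∫ x in (-R)..R, g (x + y * Complex.I)) Filter.atTop
      (𝓝 (∫ x : ℝ, g (x + y * Complex.I))) := fun y hy =>
    intervalIntegral_tendsto_integral (hint y hy) Filter.tendsto_neg_atTop_atBot Filter.tendsto_id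
  have htot := (((hl y₁ ⟨le_rfl, h12⟩).sub (hl y₂ ⟨h12, le_rfl⟩)).add
    ((hside 1 (by norm_num)).const_mul Complex.I)).sub
    ((hside (-1) (by norm_num)).const_mul Complex.I)
  simp only [hrect, mul_zero, add_zero, sub_zero] at htot
  exact sub_eq_zero.1 (tendsto_nhds_unique htot tendsto_const_nhds)

/-- A bounded holomorphic function on the upper half-plane whose vertical boundary values vanish
almost everywhere is zero. -/
theorem eq_zero_of_boundary_zero {H : ℂ → ℂ} (hH : DifferentiableOn ℂ H {z | 0 < z.im})
    {C : ℝ} (hC : ∀ z : ℂ, 0 < z.im → ‖H z‖ ≤ C)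
    (h0 : ∀ᵐ x : ℝ, Filter.Tendsto (fun y : ℝ => H (x + y * Complex.I)) (𝓝[>] 0) (𝓝 0))
    {w : ℂ} (hw : 0 < w.im) : H w = 0 := by
  have hC0 : 0 ≤ C := (norm_nonneg _).trans (hC w hw)
  have hden : ∀ z : ℂ, 0 < z.im → 1 + z.re ^ 2 ≤ ‖(z + Complex.I) ^ 2‖ := by
    intro z hz
    rw [norm_pow, ← Complex.normSq_eq_norm_sq, Complex.normSq_apply]
    simp only [Complex.add_re, Complex.I_re, add_zero, Complex.add_im, Complex.I_im]
    nlinarith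
  have hden0 : ∀ z : ℂ, 0 < z.im → (z + Complex.I) ^ 2 ≠ 0 := by
    intro z hz h
    have := hden z hz
    rw [h, norm_zero] at this
    nlinarith [sq_nonneg z.re]
  -- A Fourier character times a factor making `H` integrable on horizontal lines, uniformly down to
  -- the real axis; the pole `-i` lies outside the half-plane.
  let k : ℝ → ℂ → ℂ := fun ξ z =>
    Complex.exp (-2 * Real.pi * Complex.I * ξ * z) * ((z + Complex.I) ^ 2)⁻¹
  have hkd : ∀ ξ, DifferentiableOn ℂ (fun z => H z * k ξ z) {z | 0 < z.im} := by
    intro ξ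
    refine hH.mul (DifferentiableOn.mul (by fun_prop) (DifferentiableOn.inv (by fun_prop) hden0))
  have hkb : ∀ ξ (x y : ℝ), 0 < y → y ≤ w.im → ‖H (x + y * Complex.I) * k ξ (x + y * Complex.I)‖ ≤
      C * Real.exp (2 * Real.pi * |ξ| * w.im) * (1 + x ^ 2)⁻¹ := by
    intro ξ x y hy hyw
    have him : 0 < ((x : ℂ) + y * Complex.I).im := by simpa using hy
    simp only [k]
    rw [norm_mul, norm_mul, norm_inv, ← mul_assoc]
    have e1 : ‖Complex.exp (-2 * Real.pi * Complex.I * ξ * (x + y * Complex.I))‖ ≤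
        Real.exp (2 * Real.pi * |ξ| * w.im) := by
      rw [Complex.norm_exp]
      apply Real.exp_le_exp.2
      have : (-2 * Real.pi * Complex.I * ξ * (x + y * Complex.I)).re = 2 * Real.pi * (ξ * y) := by
        simp
        ring
      rw [this, mul_assoc (2 * Real.pi)]
      refine mul_le_mul_of_nonneg_left ?_ (by positivity)
      exact mul_le_mul (le_abs_self ξ) hyw hy.le (abs_nonneg ξ)
    have e2 : ‖((x : ℂ) + y * Complex.I + Complex.I) ^ 2‖⁻¹ ≤ (1 + x ^ 2)⁻¹ := by
      apply inv_anti₀ (by positivity)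
      simpa using hden _ him
    gcongr
    exact hC _ him
  -- The integral does not depend on the height of the line, and tends to `0` by dominated
  -- convergence as the line descends to the real axis.
  have hJ : ∀ ξ, ∫ x : ℝ, H (x + w.im * Complex.I) * k ξ (x + w.im * Complex.I) = 0 := by
    intro ξ
    have hev : ∀ᶠ y : ℝ in 𝓝[>] 0, 0 < y ∧ y ≤ w.im :=
      Filter.mem_of_superset (Ioc_mem_nhdsGT hw) fun y hy => hy
    have hlim : Filter.Tendsto
        (fun y : ℝ => ∫ x : ℝ, H (x + y * Complex.I) * k ξ (x + y * Complex.I)) (𝓝[>] 0)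
        (𝓝 (∫ _ : ℝ, (0 : ℂ))) := by
      refine tendsto_integral_filter_of_dominated_convergence
        (fun x => C * Real.exp (2 * Real.pi * |ξ| * w.im) * (1 + x ^ 2)⁻¹) ?_ ?_
        (integrable_inv_one_add_sq.const_mul _) ?_
      · filter_upwards [hev] with y hy
        apply Continuous.aestronglyMeasurable
        refine (hkd ξ).continuousOn.comp_continuous (by fun_prop) fun x => ?_
        simpa using hy.1
      · filter_upwards [hev] with y hy
        exact Filter.Eventually.of_forall fun x => hkb ξ x y hy.1 hy.2
      · filter_upwards [h0] with x hx
        have hk : Filter.Tendsto (fun y : ℝ => k ξ (x + y * Complex.I)) (𝓝[>] 0) (𝓝 (k ξ x)) := by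
          have hx0 : ((x : ℂ) + Complex.I) ^ 2 ≠ 0 := by
            refine pow_ne_zero 2 fun h => ?_
            simpa using congrArg Complex.im h
          have : ContinuousAt (fun y : ℝ => k ξ (x + y * Complex.I)) 0 := by
            refine ContinuousAt.mul (by fun_prop) (ContinuousAt.inv₀ (by fun_prop) ?_)
            simpa using hx0
          have h2 := this.tendsto
          simp only [Complex.ofReal_zero, zero_mul, add_zero] at h2
          exact h2.mono_left nhdsWithin_le_nhds
        simpa using hx.mul hk
    have hconst : ∀ᶠ y : ℝ in 𝓝[>] 0,
        ∫ x : ℝ, H (x + y * Complex.I) * k ξ (x + y * Complex.I) =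
        ∫ x : ℝ, H (x + w.im * Complex.I) * k ξ (x + w.im * Complex.I) := by
      filter_upwards [hev] with y hy
      exact integral_horizontal_eq (hkd ξ) hy.1 hy.2 fun x t ht =>
        hkb ξ x t (hy.1.trans_le ht.1) ht.2
    rw [integral_zero] at hlim
    exact tendsto_nhds_unique (hlim.congr' hconst) tendsto_const_nhds |>.symm
  let u : ℝ → ℂ := fun x => H (x + w.im * Complex.I) * k 0 (x + w.im * Complex.I)
  have hucont : Continuous u :=
    (hkd 0).continuousOn.comp_continuous (by fun_prop) fun x => by simpa using hw
  have huint : Integrable u :=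
    (integrable_inv_one_add_sq.const_mul _).mono' hucont.aestronglyMeasurable
      (Filter.Eventually.of_forall fun x => hkb 0 x w.im hw le_rfl)
  have hF : FourierTransform.fourier u = 0 := by
    funext ξ
    rw [Real.fourier_real_eq_integral_exp_smul]
    -- On the line at height `w.im` the kernel is the ordinary Fourier character up to a non-zero
    -- factor independent of `x`, so all Fourier coefficients of `u` vanish and inversion gives `u =
    -- 0`.
    have h2 : ∀ x : ℝ, H (x + w.im * Complex.I) * k ξ (x + w.im * Complex.I) =
        Complex.exp (2 * Real.pi * ξ * w.im) *
          (Complex.exp (((-2 * Real.pi * x * ξ : ℝ) : ℂ) * Complex.I) • u x) := by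
      intro x
      simp only [u, k, smul_eq_mul]
      have : (-2 * Real.pi * Complex.I * ξ * (x + w.im * Complex.I) : ℂ) =
          2 * Real.pi * ξ * w.im + ((-2 * Real.pi * x * ξ : ℝ) : ℂ) * Complex.I := by
        push_cast
        linear_combination (-2 * Real.pi * ξ * w.im : ℂ) * Complex.I_mul_I
      rw [this, Complex.exp_add]
      simp only [Complex.ofReal_zero, mul_zero, zero_mul, Complex.exp_zero, one_mul]
      ring
    have h3 := hJ ξ
    simp only [h2] at h3
    rw [integral_const_mul] at h3
    exact (mul_eq_zero.1 h3).resolve_left (Complex.exp_ne_zero _)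
  have hinv := hucont.fourierInv_fourier_eq huint (by rw [hF]; exact integrable_zero _ _ _)
  have hu0 : u w.re = 0 := by
    rw [← hinv, hF, Real.fourierInv_eq]
    simp
  simp only [u, k, Complex.re_add_im, Complex.ofReal_zero, mul_zero, zero_mul, Complex.exp_zero,
    one_mul] at hu0
  exact (mul_eq_zero.1 hu0).resolve_right (inv_ne_zero (hden0 w hw))

/-! ### The functional equation and its logarithmic derivative -/

/-- The product by which the scattering operator multiplies two particles of momenta `p, q` and
two particles of momenta `a, b`, for a function `f` with `check f = conj f`. -/
def crossProduct (f : ℝ → ℂ) (p q a b : ℝ) : ℂ :=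
  f (p * a) * conj (f (p * b)) * conj (f (q * a)) * f (q * b)

/-- The product `crossProduct f p q a b` depends on `p` and `q` only through `p + q`. -/
def IsSumInvariant (f : ℝ → ℂ) : Prop :=
  ∀ p q p' q' a b : ℝ, 0 < p → 0 < q → 0 < p' → 0 < q' → 0 < a → 0 < b → p + q = p' + q' →
    crossProduct f p q a b = crossProduct f p' q' a b

/-- Compare the splittings `y + y` and `x + (2 y - x)` of the same sum, with `a = b = 1`: the first
product is `|f y| ^ 4`, the second contains the factor `f x`. -/
theorem IsSumInvariant.eq_zero_of_half_lt {f : ℝ → ℂ} (hE : IsSumInvariant f) {x y : ℝ}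
    (hx : 0 < x) (h0 : f x = 0) (hy : x / 2 < y) : f y = 0 := by
  have hy0 : 0 < y := by linarith
  have h := hE y y x (2 * y - x) 1 1 hy0 hy0 hx (by linarith) one_pos one_pos (by ring)
  simpa [crossProduct, h0] using h

/-- The product is constant along `h ↦ (p + h, q - h)`; differentiate at `h = 0` and divide by the
product. -/
theorem IsSumInvariant.logDeriv {f f' : ℝ → ℂ} (hE : IsSumInvariant f)
    (hf : ∀ x, 0 < x → HasDerivAt f (f' x) x) (hne : ∀ x, 0 < x → f x ≠ 0)
    {p q a b : ℝ} (hp : 0 < p) (hq : 0 < q) (ha : 0 < a) (hb : 0 < b) :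
    a * (f' (p * a) / f (p * a)) + b * conj (f' (p * b) / f (p * b)) -
      a * conj (f' (q * a) / f (q * a)) - b * (f' (q * b) / f (q * b)) = 0 := by
  have hd : ∀ (r s c : ℝ), 0 < r → 0 < c →
      HasDerivAt (fun h : ℝ => f ((r + s * h) * c)) ((s * c : ℝ) * f' (r * c)) 0 := by
    intro r s c hr hc
    have h1 : HasDerivAt (fun h : ℝ => (r + s * h) * c) (s * c) 0 := by
      simpa using (((hasDerivAt_id (0 : ℝ)).const_mul s).const_add r).mul_const c
    have h2 : HasDerivAt f (f' (r * c)) ((r + s * 0) * c) := by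
      simpa using hf (r * c) (by positivity)
    simpa [Function.comp_def] using h2.scomp (0 : ℝ) h1
  have hs : ∀ (r s c : ℝ), 0 < r → 0 < c →
      HasDerivAt (fun h : ℝ => conj (f ((r + s * h) * c))) (conj ((s * c : ℝ) * f' (r * c))) 0 :=
    fun r s c hr hc => (hd r s c hr hc).star
  have hprod := (((hd p 1 a hp ha).mul (hs p 1 b hp hb)).mul (hs q (-1) a hq ha)).mul
    (hd q (-1) b hq hb)
  have hev : (fun h : ℝ => crossProduct f (p + 1 * h) (q + -1 * h) a b) =ᶠ[𝓝 0]
      fun _ => crossProduct f p q a b := by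
    have h1 : ∀ᶠ h : ℝ in 𝓝 0, 0 < p + 1 * h :=
      (by fun_prop : ContinuousAt (fun h : ℝ => p + 1 * h) 0).eventually
        (lt_mem_nhds (by simpa using hp))
    have h2 : ∀ᶠ h : ℝ in 𝓝 0, 0 < q + -1 * h :=
      (by fun_prop : ContinuousAt (fun h : ℝ => q + -1 * h) 0).eventually
        (lt_mem_nhds (by simpa using hq))
    filter_upwards [h1, h2] with h h1 h2
    exact hE _ _ _ _ _ _ h1 h2 hp hq ha hb (by ring)
  have hzero := hprod.unique ((hasDerivAt_const (0 : ℝ) _).congr_of_eventuallyEq hev)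
  simp only [Pi.mul_apply, mul_zero, add_zero, map_mul, Complex.conj_ofReal, one_mul, neg_mul,
    Complex.ofReal_neg, map_neg, neg_zero] at hzero
  have n1 := hne (p * a) (by positivity)
  have n2 := (map_ne_zero (starRingEnd ℂ)).2 (hne (p * b) (by positivity))
  have n3 := (map_ne_zero (starRingEnd ℂ)).2 (hne (q * a) (by positivity))
  have n4 := hne (q * b) (by positivity)
  simp only [map_div₀]
  generalize f (p * a) = f1, conj (f (p * b)) = f2, conj (f (q * a)) = f3, f (q * b) = f4 at *
  generalize f' (p * a) = g1, conj (f' (p * b)) = g2, conj (f' (q * a)) = g3, f' (q * b) = g4 at *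
  field_simp
  linear_combination hzero

/-- The logarithmic derivative of a non-vanishing function with the invariance property is
`x ↦ -κ + i e / x` with real `κ` and `e`. -/
theorem IsSumInvariant.exists_deriv_eq {f f' : ℝ → ℂ} (hE : IsSumInvariant f)
    (hf : ∀ x, 0 < x → HasDerivAt f (f' x) x) (hne : ∀ x, 0 < x → f x ≠ 0) :
    ∃ κ e : ℝ, ∀ x : ℝ, 0 < x → x * f' x = (-κ * x + Complex.I * e) * f x := by
  -- Let `L = f' / f`. The choice `p = x`, `q = a = b = 1` shows that `Re L` is constant; `a = x`,
  -- `p = q = b = 1` shows that `x * Im L x` is constant. Both constants are read off at `1`.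
  refine ⟨-(f' 1 / f 1).re, (f' 1 / f 1).im, fun x hx => ?_⟩
  have h1 := hE.logDeriv hf hne hx one_pos one_pos one_pos
  have h2 := hE.logDeriv hf hne one_pos one_pos hx one_pos
  simp only [mul_one, one_mul, Complex.ofReal_one] at h1 h2
  have hre := congrArg Complex.re h1
  have him := congrArg Complex.im h2
  simp only [Complex.add_re, Complex.sub_re, Complex.conj_re, Complex.zero_re, Complex.add_im,
    Complex.sub_im, Complex.conj_im, Complex.zero_im, Complex.im_ofReal_mul] at hre him
  have hL : x * (f' x / f x) = -(-(f' 1 / f 1).re : ℝ) * x + Complex.I * ((f' 1 / f 1).im : ℝ) := by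
    apply Complex.ext
    · simp only [Complex.add_re, Complex.mul_re, Complex.neg_re,
        Complex.neg_im, Complex.ofReal_re, Complex.ofReal_im, Complex.I_re, Complex.I_im]
      linear_combination (x / 2) * hre
    · simp only [Complex.add_im, Complex.mul_im, Complex.neg_re,
        Complex.neg_im, Complex.ofReal_re, Complex.ofReal_im, Complex.I_re, Complex.I_im]
      linear_combination him / 2
  rw [← hL, mul_assoc, div_mul_cancel₀ _ (hne x hx)]

/-! ### From the functional equation to exponentials -/

theorem isPreconnected_upperHalf : IsPreconnected {z : ℂ | 0 < z.im} :=
  (convex_halfSpace_im_gt 0).isPreconnected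

theorem isOpen_upperHalf : IsOpen {z : ℂ | 0 < z.im} :=
  isOpen_lt continuous_const Complex.continuous_im

/-- Holomorphic functions on the upper half-plane are determined by their values on an interval of
the imaginary axis. -/
theorem eqOn_upperHalf_of_imaginary {F G : ℂ → ℂ} (hF : DifferentiableOn ℂ F {z | 0 < z.im})
    (hG : DifferentiableOn ℂ G {z | 0 < z.im}) {r : ℝ} (hr : 0 ≤ r)
    (h : ∀ x : ℝ, r < x → F (x * Complex.I) = G (x * Complex.I)) :
    Set.EqOn F G {z | 0 < z.im} := by
  have hpos : 0 < r + 1 := by linarith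
  refine (hF.analyticOnNhd isOpen_upperHalf).eqOn_of_preconnected_of_frequently_eq
    (hG.analyticOnNhd isOpen_upperHalf) isPreconnected_upperHalf
    (z₀ := ((r + 1 : ℝ) : ℂ) * Complex.I) (by simpa using hpos) ?_
  have ht : Filter.Tendsto (fun x : ℝ => (x : ℂ) * Complex.I) (𝓝[>] (r + 1))
      (𝓝[≠] (((r + 1 : ℝ) : ℂ) * Complex.I)) := by
    refine tendsto_nhdsWithin_iff.2 ⟨?_, ?_⟩
    · exact ((by fun_prop : Continuous fun x : ℝ => (x : ℂ) * Complex.I).tendsto _).mono_left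
        nhdsWithin_le_nhds
    · filter_upwards [self_mem_nhdsWithin] with x hx heq
      have := congrArg Complex.im heq
      simp at this
      simp [this] at hx
  refine ht.frequently (Filter.Eventually.frequently ?_)
  filter_upwards [self_mem_nhdsWithin] with x hx
  exact h x (by have : r + 1 < x := hx; linarith)

/-- An inner function whose holomorphic extension has the invariance property on the imaginary
axis is an exponential. -/
theorem isExponential_of_isSumInvariant {φ : ℝ → ℂ} {F : ℂ → ℂ}
    (hF : DifferentiableOn ℂ F {z | 0 < z.im})
    (hlim : ∀ᵐ x : ℝ, Filter.Tendsto (fun y : ℝ => F (x + y * Complex.I)) (𝓝[>] 0) (𝓝 (φ x)) ∧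
      ‖φ x‖ = 1)
    (hE : IsSumInvariant fun x => F (x * Complex.I)) : IsExponential φ := by
  have hFd : ∀ z : ℂ, 0 < z.im → HasDerivAt F (deriv F z) z := fun z hz =>
    (hF.differentiableAt (isOpen_upperHalf.mem_nhds hz)).hasDerivAt
  -- A zero makes `F` vanish on a half-line of the imaginary axis, hence identically, against
  -- boundary values of modulus `1`.
  have hne : ∀ x : ℝ, 0 < x → F (x * Complex.I) ≠ 0 := by
    intro x hx h0
    have hz : Set.EqOn F (fun _ => 0) {z | 0 < z.im} :=
      eqOn_upperHalf_of_imaginary hF (by fun_prop) (half_pos hx).le fun y hy =>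
        hE.eq_zero_of_half_lt hx h0 hy
    obtain ⟨t, ht, ht1⟩ := hlim.exists
    have : Filter.Tendsto (fun y : ℝ => F (t + y * Complex.I)) (𝓝[>] 0) (𝓝 0) := by
      refine tendsto_const_nhds.congr' ?_
      filter_upwards [self_mem_nhdsWithin] with y hy
      have hy : 0 < y := hy
      exact (hz (show 0 < ((t : ℂ) + y * Complex.I).im by simpa using hy)).symm
    rw [tendsto_nhds_unique ht this, norm_zero] at ht1
    exact zero_ne_one ht1
  have hfd : ∀ x : ℝ, 0 < x → HasDerivAt (fun x : ℝ => F (x * Complex.I))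
      (deriv F (x * Complex.I) * Complex.I) x := by
    intro x hx
    have h1 : HasDerivAt (fun z : ℂ => z * Complex.I) Complex.I (x : ℂ) := by
      simpa using (hasDerivAt_id (x : ℂ)).mul_const Complex.I
    exact ((hFd (x * Complex.I) (by simpa using hx)).comp (x : ℂ) h1).comp_ofReal
  obtain ⟨κ, e, hκ⟩ := hE.exists_deriv_eq hfd hne
  have hFd' : DifferentiableOn ℂ (deriv F) {z | 0 < z.im} := hF.deriv isOpen_upperHalf
  have hode : Set.EqOn (fun z => z * deriv F z)
      (fun z => (Complex.I * κ * z + Complex.I * e) * F z) {z | 0 < z.im} := by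
    refine eqOn_upperHalf_of_imaginary (by fun_prop) (by fun_prop) le_rfl fun x hx => ?_
    have := hκ x hx
    linear_combination this + (-κ * x * F (x * Complex.I)) * Complex.I_mul_I
  -- Multiplication by `-i` turns the closed upper half-plane into the closed right half-plane,
  -- which without `0` avoids the cut. So `log (-i z)` is holomorphic inside and continuous up to
  -- the real line minus the origin.
  have hslit : ∀ z : ℂ, z ≠ 0 → 0 ≤ z.im → -Complex.I * z ∈ Complex.slitPlane := by
    intro z hz hz0
    rw [Complex.mem_slitPlane_iff]
    simp only [Complex.mul_re, Complex.neg_re, Complex.I_re, Complex.neg_im, Complex.I_im,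
      Complex.mul_im]
    rcases hz0.lt_or_eq with h | h
    · left
      linarith
    · right
      intro h2
      apply hz
      apply Complex.ext
      · simp only [Complex.zero_re]; linarith
      · exact h.symm
  let E : ℂ → ℂ := fun z =>
    Complex.exp (Complex.I * κ * z + Complex.I * e * Complex.log (-Complex.I * z))
  have hEd : ∀ z : ℂ, 0 < z.im → HasDerivAt E
      (E z * (Complex.I * κ + Complex.I * e * (-Complex.I / (-Complex.I * z)))) z := by
    intro z hz
    have hz0 : z ≠ 0 := by rintro rfl; simp at hz
    have h1 : HasDerivAt (fun z : ℂ => -Complex.I * z) (-Complex.I) z := by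
      simpa using (hasDerivAt_id z).const_mul (-Complex.I)
    have h2 : HasDerivAt (fun z : ℂ => Complex.I * κ * z) (Complex.I * κ) z := by
      simpa using (hasDerivAt_id z).const_mul (Complex.I * κ)
    exact (h2.add ((h1.clog (hslit z hz0 hz.le)).const_mul (Complex.I * e))).cexp
  -- `E` solves the same first-order equation as `F` and has no zeros, so the quotient is constant.
  have hquot : ∀ z : ℂ, 0 < z.im → HasDerivAt (fun z => F z / E z) 0 z := by
    intro z hz
    have hz0 : z ≠ 0 := by rintro rfl; simp at hz
    have hEz : E z ≠ 0 := Complex.exp_ne_zero _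
    have hd := (hFd z hz).div (hEd z hz) hEz
    convert! hd using 1
    have ho := hode hz
    have hI := Complex.I_ne_zero
    field_simp
    linear_combination -ho
  obtain ⟨C, hC⟩ : ∃ C : ℂ, ∀ z : ℂ, 0 < z.im → F z = C * E z := by
    refine ⟨F Complex.I / E Complex.I, fun z hz => ?_⟩
    have := isOpen_upperHalf.is_const_of_deriv_eq_zero isPreconnected_upperHalf
      (fun w hw => (hquot w hw).differentiableAt.differentiableWithinAt)
      (fun w hw => (hquot w hw).deriv) hz (show 0 < Complex.I.im by simp)
    rw [← this, div_mul_cancel₀ _ (Complex.exp_ne_zero _)]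
  have hval : ∀ᵐ x : ℝ, φ x = C * E x ∧ ‖φ x‖ = 1 := by
    have hnz : ∀ᵐ x : ℝ, x ≠ 0 := by simp [ae_iff]
    filter_upwards [hlim, hnz] with x hx hx0
    refine ⟨?_, hx.2⟩
    have hcont : ContinuousAt (fun y : ℝ => C * E (x + y * Complex.I)) 0 := by
      refine continuousAt_const.mul (Complex.continuous_exp.continuousAt.comp ?_)
      refine ContinuousAt.add (by fun_prop) (continuousAt_const.mul ?_)
      refine ContinuousAt.clog (by fun_prop) (hslit _ ?_ ?_) <;> simp [hx0]
    have ht := hcont.tendsto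
    simp only [Complex.ofReal_zero, zero_mul, add_zero] at ht
    refine tendsto_nhds_unique hx.1 ((ht.mono_left nhdsWithin_le_nhds).congr' ?_)
    filter_upwards [self_mem_nhdsWithin] with y hy
    have hy : 0 < y := hy
    exact (hC _ (by simpa using hy)).symm
  have hnorm : ∀ x : ℝ, ‖E x‖ = Real.exp (-e * Complex.arg (-Complex.I * x)) := by
    intro x
    simp only [E]
    rw [Complex.norm_exp, ← Complex.log_im]
    congr 1
    simp
  -- The modulus of `E` is constant on each real half-line, so one point of each, taken from the set
  -- of full measure, suffices.
  have hset : ∀ s : Set ℝ, IsOpen s → s.Nonempty → ∃ x ∈ s, ‖C * E x‖ = 1 := by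
    intro s hs hsn
    have hp : volume s ≠ 0 := (hs.measure_pos volume hsn).ne'
    obtain ⟨x, hxs, hx⟩ := (frequently_ae_mem_iff.2 hp).and_eventually hval |>.exists
    exact ⟨x, hxs, hx.1 ▸ hx.2⟩
  obtain ⟨x, hx, hx1⟩ := hset (Set.Ioi 0) isOpen_Ioi ⟨1, Set.mem_Ioi.2 one_pos⟩
  obtain ⟨y, hy, hy1⟩ := hset (Set.Iio 0) isOpen_Iio ⟨-1, by simp⟩
  have hx : 0 < x := hx
  have hy : y < 0 := hy
  have hargx : Complex.arg (-Complex.I * x) = -(Real.pi / 2) := by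
    rw [Complex.arg_eq_neg_pi_div_two_iff]
    simpa using hx
  have hargy : Complex.arg (-Complex.I * y) = Real.pi / 2 := by
    rw [Complex.arg_eq_pi_div_two_iff]
    simpa using hy
  rw [norm_mul, hnorm, hargx] at hx1
  rw [norm_mul, hnorm, hargy] at hy1
  have hC0 : ‖C‖ ≠ 0 := by
    intro h
    rw [h, zero_mul] at hx1
    exact zero_ne_one hx1
  -- The two points give `|C| exp (e π / 2) = 1 = |C| exp (-e π / 2)`.
  have he : e = 0 := by
    have h1 := mul_left_cancel₀ hC0 (hx1.trans hy1.symm)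
    have h2 := Real.exp_injective h1
    have h3 : e * Real.pi = 0 := by linarith
    exact (mul_eq_zero.1 h3).resolve_right Real.pi_ne_zero
  have hC1 : ‖C‖ = 1 := by simpa [he] using hx1
  refine ⟨κ, Complex.arg C, ?_⟩
  filter_upwards [hval] with t ht
  have hCe : C = Complex.exp (Complex.arg C * Complex.I) := by
    have := Complex.norm_mul_exp_arg_mul_I C
    rw [hC1] at this
    simpa using this.symm
  rw [ht.1]
  nth_rw 1 [hCe]
  rw [← Complex.exp_add]
  congr 1
  rw [he]
  push_cast
  ring

/-! ### Continuation of the phase from real momenta to the imaginary axis -/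

/-- The holomorphic function `z ↦ conj (F (-conj z))` on the upper half-plane. -/
def reflection (F : ℂ → ℂ) (z : ℂ) : ℂ := conj (F (-conj z))

theorem differentiableOn_reflection {F : ℂ → ℂ} (hF : DifferentiableOn ℂ F {z | 0 < z.im}) :
    DifferentiableOn ℂ (reflection F) {z | 0 < z.im} := by
  intro z hz
  have hz : 0 < z.im := hz
  have h1 : DifferentiableAt ℂ F (-conj z) :=
    hF.differentiableAt (isOpen_upperHalf.mem_nhds (by simpa using hz))
  have h2 : DifferentiableAt ℂ (fun w => F (-w)) (conj z) :=
    DifferentiableAt.comp (conj z) h1 (by fun_prop)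
  rw [← Complex.conj_conj z]
  exact h2.conj_conj.differentiableWithinAt

/-- The image of Haar measure under a surjective linear map is a multiple of Haar measure, so null
sets pull back to null sets. It justifies the linear substitutions made in almost-everywhere
statements. -/
theorem quasiMeasurePreserving_linear {E F : Type*} [NormedAddCommGroup E] [NormedSpace ℝ E]
    [MeasurableSpace E] [BorelSpace E] [NormedAddCommGroup F] [NormedSpace ℝ F] [MeasurableSpace F]
    [BorelSpace F] [FiniteDimensional ℝ E] [FiniteDimensional ℝ F]
    (μ : Measure E) (ν : Measure F) [μ.IsAddHaarMeasure] [ν.IsAddHaarMeasure] (L : E →ₗ[ℝ] F)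
    (hL : Function.Surjective L) : Measure.QuasiMeasurePreserving L μ ν := by
  obtain ⟨c, -, hc⟩ := L.exists_map_addHaar_eq_smul_addHaar μ ν hL
  refine ⟨L.continuous_of_finiteDimensional.measurable, ?_⟩
  rw [hc]
  exact Measure.smul_absolutelyContinuous

/-- On every fibre with non-zero first coordinate the map is a dilation, and the remaining fibre is
negligible. -/
theorem quasiMeasurePreserving_skew : Measure.QuasiMeasurePreserving
    (fun w : ℝ × ℝ => (w.1, w.1 * w.2)) volume volume := by
  refine ⟨by fun_prop, Measure.AbsolutelyContinuous.mk fun s hs h0 => ?_⟩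
  have hm : Measurable fun w : ℝ × ℝ => (w.1, w.1 * w.2) := by fun_prop
  rw [Measure.map_apply hm hs, Measure.volume_eq_prod, Measure.measure_prod_null (hm hs)]
  rw [Measure.volume_eq_prod, Measure.measure_prod_null hs] at h0
  have hnz : ∀ᵐ x : ℝ, x ≠ 0 := by simp [ae_iff]
  filter_upwards [h0, hnz] with z hz hz0
  have : Prod.mk z ⁻¹' ((fun w : ℝ × ℝ => (w.1, w.1 * w.2)) ⁻¹' s) =
      (fun x => z * x) ⁻¹' (Prod.mk z ⁻¹' s) := rfl
  rw [this, Real.volume_preimage_mul_left hz0]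
  simp only [Pi.zero_apply] at hz
  rw [hz, mul_zero, Pi.zero_apply]

/-- The function by which the scattering operator multiplies on two pairs of opposite charges,
extended to signed momenta. -/
def signedPhase (φ : ℝ → ℂ) (p q a b : ℝ) : ℂ :=
  φ (p * a) * check φ (p * b) * check φ (q * a) * φ (q * b)

/-- Substitute `p = t x`, `q = t (1 - x)`, whose sum `t` is free of `x`, and eliminate `G` between
two values of `x`. The sign condition becomes `t ^ 2 * x * (1 - x) > 0`, so both signs of `t` are
covered. The quantifier over `t` stands inside, ready for boundary values in `t` with the other
variables fixed. -/
theorem ae_signedPhase_eq {φ : ℝ → ℂ} {G : ℝ → ℝ → ℂ}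
    (h : ∀ᵐ z : (ℝ × ℝ) × (ℝ × ℝ), 0 < z.1.1 * z.1.2 → 0 < z.2.1 → 0 < z.2.2 →
      signedPhase φ z.1.1 z.1.2 z.2.1 z.2.2 = G (z.1.1 + z.1.2) (z.2.1 + z.2.2)) :
    ∀ᵐ w : (ℝ × ℝ) × (ℝ × ℝ), ∀ᵐ t : ℝ, (0 < w.1.1 ∧ w.1.1 < 1) → (0 < w.1.2 ∧ w.1.2 < 1) →
      0 < w.2.1 → 0 < w.2.2 →
      signedPhase φ (t * w.1.1) (t * (1 - w.1.1)) w.2.1 w.2.2 =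
        signedPhase φ (t * w.1.2) (t * (1 - w.1.2)) w.2.1 w.2.2 := by
  -- After `(t, x) ↦ (t, t x)`, this map gives `(t x, t - t x)`.
  let L : ℝ × ℝ →ₗ[ℝ] ℝ × ℝ := (LinearMap.snd ℝ ℝ ℝ).prod (LinearMap.fst ℝ ℝ ℝ - LinearMap.snd ℝ ℝ ℝ)
  have hL : Measure.QuasiMeasurePreserving L volume volume :=
    quasiMeasurePreserving_linear _ _ L fun y => ⟨(y.1 + y.2, y.1), by simp [L]⟩
  have hU := QuasiMeasurePreserving.prodMap (hL.comp quasiMeasurePreserving_skew)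
    (Measure.QuasiMeasurePreserving.id (volume : Measure (ℝ × ℝ)))
  -- From `(((x, x'), (a, b)), t)` the maps `e1` and `e2` select `((t, x), (a, b))` and `((t, x'),
  -- (a, b))`.
  let e1 : ((ℝ × ℝ) × (ℝ × ℝ)) × ℝ →ₗ[ℝ] (ℝ × ℝ) × (ℝ × ℝ) :=
    ((LinearMap.snd ℝ _ _).prod (LinearMap.fst ℝ ℝ ℝ ∘ₗ LinearMap.fst ℝ _ _ ∘ₗ
      LinearMap.fst ℝ _ _)).prod (LinearMap.snd ℝ _ _ ∘ₗ LinearMap.fst ℝ _ _)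
  let e2 : ((ℝ × ℝ) × (ℝ × ℝ)) × ℝ →ₗ[ℝ] (ℝ × ℝ) × (ℝ × ℝ) :=
    ((LinearMap.snd ℝ _ _).prod (LinearMap.snd ℝ ℝ ℝ ∘ₗ LinearMap.fst ℝ _ _ ∘ₗ
      LinearMap.fst ℝ _ _)).prod (LinearMap.snd ℝ _ _ ∘ₗ LinearMap.fst ℝ _ _)
  have i4 : (volume : Measure ((ℝ × ℝ) × (ℝ × ℝ))).IsAddHaarMeasure :=
    Measure.prod.instIsAddHaarMeasure _ _
  have i5 : (volume : Measure (((ℝ × ℝ) × (ℝ × ℝ)) × ℝ)).IsAddHaarMeasure :=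
    Measure.prod.instIsAddHaarMeasure _ _
  have he1 : Measure.QuasiMeasurePreserving e1 volume volume :=
    quasiMeasurePreserving_linear _ _ e1 fun y => ⟨(((y.1.2, 0), y.2), y.1.1), by simp [e1]⟩
  have he2 : Measure.QuasiMeasurePreserving e2 volume volume :=
    quasiMeasurePreserving_linear _ _ e2 fun y => ⟨(((0, y.1.2), y.2), y.1.1), by simp [e2]⟩
  have h1 := (hU.comp he1).ae h
  have h2 := (hU.comp he2).ae h
  have hnz : ∀ᵐ x : ℝ, x ≠ 0 := by simp [ae_iff]
  filter_upwards [Measure.ae_ae_of_ae_prod h1, Measure.ae_ae_of_ae_prod h2] with w hw1 hw2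
  filter_upwards [hw1, hw2, hnz] with t ht1 ht2 ht0 hx hx' ha hb
  change 0 < t * w.1.1 * (t - t * w.1.1) → 0 < w.2.1 → 0 < w.2.2 →
    signedPhase φ (t * w.1.1) (t - t * w.1.1) w.2.1 w.2.2 =
      G (t * w.1.1 + (t - t * w.1.1)) (w.2.1 + w.2.2) at ht1
  change 0 < t * w.1.2 * (t - t * w.1.2) → 0 < w.2.1 → 0 < w.2.2 →
    signedPhase φ (t * w.1.2) (t - t * w.1.2) w.2.1 w.2.2 =
      G (t * w.1.2 + (t - t * w.1.2)) (w.2.1 + w.2.2) at ht2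
  have hpos : ∀ x : ℝ, 0 < x → x < 1 → 0 < t * x * (t - t * x) := by
    intro x h0 h1
    have := mul_pos (mul_pos h0 (sub_pos.2 h1)) (sq_pos_of_ne_zero ht0)
    linarith [this, (by ring : x * (1 - x) * t ^ 2 = t * x * (t - t * x))]
  have r1 := ht1 (hpos _ hx.1 hx.2) ha hb
  have r2 := ht2 (hpos _ hx'.1 hx'.2) ha hb
  rw [mul_sub, mul_sub, mul_one, r1, r2, add_sub_cancel, add_sub_cancel]

/-- The holomorphic extension of `t ↦ signedPhase φ (t * p) (t * q) a b`. -/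
def phaseExtension (F : ℂ → ℂ) (p q a b : ℝ) (z : ℂ) : ℂ :=
  F ((p * a : ℝ) * z) * reflection F ((p * b : ℝ) * z) * reflection F ((q * a : ℝ) * z) *
    F ((q * b : ℝ) * z)

theorem mapsTo_mul_upperHalf {c : ℝ} (hc : 0 < c) :
    Set.MapsTo (fun z : ℂ => (c : ℂ) * z) {z | 0 < z.im} {z | 0 < z.im} := by
  intro z hz
  have hz : 0 < z.im := hz
  change 0 < ((c : ℂ) * z).im
  rw [Complex.im_ofReal_mul]
  positivity

section Extension

variable {φ : ℝ → ℂ} {F : ℂ → ℂ} {p q a b : ℝ}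

theorem differentiableOn_phaseExtension (hF : DifferentiableOn ℂ F {z | 0 < z.im})
    (hp : 0 < p) (hq : 0 < q) (ha : 0 < a) (hb : 0 < b) :
    DifferentiableOn ℂ (phaseExtension F p q a b) {z | 0 < z.im} := by
  have hR := differentiableOn_reflection hF
  refine DifferentiableOn.mul (DifferentiableOn.mul (DifferentiableOn.mul ?_ ?_) ?_) ?_
  · exact hF.comp (by fun_prop) (mapsTo_mul_upperHalf (mul_pos hp ha))
  · exact hR.comp (by fun_prop) (mapsTo_mul_upperHalf (mul_pos hp hb))
  · exact hR.comp (by fun_prop) (mapsTo_mul_upperHalf (mul_pos hq ha))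
  · exact hF.comp (by fun_prop) (mapsTo_mul_upperHalf (mul_pos hq hb))

theorem norm_phaseExtension_le {C : ℝ} (hC : ∀ z : ℂ, 0 < z.im → ‖F z‖ ≤ C)
    (hp : 0 < p) (hq : 0 < q) (ha : 0 < a) (hb : 0 < b) {z : ℂ} (hz : 0 < z.im) :
    ‖phaseExtension F p q a b z‖ ≤ C * C * C * C := by
  have hC0 : 0 ≤ C := (norm_nonneg _).trans (hC z hz)
  have hR : ∀ z : ℂ, 0 < z.im → ‖reflection F z‖ ≤ C := by
    intro z hz
    unfold reflection
    rw [RCLike.norm_conj]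
    exact hC _ (by simpa using hz)
  unfold phaseExtension
  rw [norm_mul, norm_mul, norm_mul]
  gcongr
  · exact hC _ (mapsTo_mul_upperHalf (mul_pos hp ha) hz)
  · exact hR _ (mapsTo_mul_upperHalf (mul_pos hp hb) hz)
  · exact hR _ (mapsTo_mul_upperHalf (mul_pos hq ha) hz)
  · exact hC _ (mapsTo_mul_upperHalf (mul_pos hq hb) hz)

/-- Positive dilations preserve vertical approach to the real line. The map `z ↦ -conj z` exchanges
the approaches to `t` and `-t`, so the reflection has boundary value `check φ`. -/
theorem ae_tendsto_phaseExtension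
    (hlim : ∀ᵐ x : ℝ, Filter.Tendsto (fun y : ℝ => F (x + y * Complex.I)) (𝓝[>] 0) (𝓝 (φ x)))
    (hp : 0 < p) (hq : 0 < q) (ha : 0 < a) (hb : 0 < b) :
    ∀ᵐ t : ℝ, Filter.Tendsto (fun y : ℝ => phaseExtension F p q a b (t + y * Complex.I)) (𝓝[>] 0)
      (𝓝 (signedPhase φ (t * p) (t * q) a b)) := by
  have hscale : ∀ c : ℝ, 0 < c → Filter.Tendsto (fun y : ℝ => c * y) (𝓝[>] 0) (𝓝[>] 0) := by
    intro c hc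
    refine tendsto_nhdsWithin_iff.2 ⟨?_, ?_⟩
    · have : Filter.Tendsto (fun y : ℝ => c * y) (𝓝 0) (𝓝 (c * 0)) :=
        (continuous_const_mul c).tendsto 0
      rw [mul_zero] at this
      exact this.mono_left nhdsWithin_le_nhds
    · filter_upwards [self_mem_nhdsWithin] with y hy
      exact mul_pos hc hy
  have hq1 : ∀ c : ℝ, c ≠ 0 → Measure.QuasiMeasurePreserving (fun t : ℝ => c * t) volume volume := by
    intro c hc
    refine ⟨by fun_prop, Measure.AbsolutelyContinuous.mk fun s hs h2 => ?_⟩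
    rw [Measure.map_apply (by fun_prop) hs, Real.volume_preimage_mul_left hc, h2, mul_zero]
  have hFl : ∀ c : ℝ, 0 < c → ∀ᵐ t : ℝ, Filter.Tendsto
      (fun y : ℝ => F ((c : ℂ) * (t + y * Complex.I))) (𝓝[>] 0) (𝓝 (φ (c * t))) := by
    intro c hc
    filter_upwards [(hq1 c hc.ne').ae hlim] with t ht
    refine (ht.comp (hscale c hc)).congr fun y => ?_
    simp only [Function.comp_apply]
    push_cast
    ring_nf
  have hRl : ∀ c : ℝ, 0 < c → ∀ᵐ t : ℝ, Filter.Tendsto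
      (fun y : ℝ => reflection F ((c : ℂ) * (t + y * Complex.I))) (𝓝[>] 0)
      (𝓝 (check φ (c * t))) := by
    intro c hc
    filter_upwards [(hq1 (-c) (neg_ne_zero.2 hc.ne')).ae hlim] with t ht
    have h2 := (Complex.continuous_conj.tendsto _).comp (ht.comp (hscale c hc))
    rw [neg_mul] at h2
    refine h2.congr fun y => ?_
    simp only [Function.comp_apply, reflection]
    congr 2
    simp only [map_mul, map_add, Complex.conj_ofReal, Complex.conj_I]
    push_cast
    ring
  filter_upwards [hFl _ (mul_pos hp ha), hRl _ (mul_pos hp hb), hRl _ (mul_pos hq ha),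
    hFl _ (mul_pos hq hb)] with t h1 h2 h3 h4
  have h := ((h1.mul h2).mul h3).mul h4
  have e : ∀ r s : ℝ, t * r * s = r * s * t := fun r s => by ring
  simpa only [signedPhase, phaseExtension, e] using h

/-- The imaginary axis is fixed by `z ↦ -conj z`, so the reflection is there the plain conjugate of
`F`. -/
theorem phaseExtension_I :
    phaseExtension F p q a b Complex.I = crossProduct (fun x => F (x * Complex.I)) p q a b := by
  simp only [phaseExtension, crossProduct, reflection, map_mul, Complex.conj_ofReal, Complex.conj_I,
    mul_neg, neg_neg]

end Extension

/-- If the phase depends only on the total momenta almost everywhere, then the holomorphic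
extension of the inner function has the invariance property on the imaginary axis. -/
theorem isSumInvariant_of_ae {φ : ℝ → ℂ} {F : ℂ → ℂ}
    (hF : DifferentiableOn ℂ F {z | 0 < z.im}) {C : ℝ} (hC : ∀ z : ℂ, 0 < z.im → ‖F z‖ ≤ C)
    (hlim : ∀ᵐ x : ℝ, Filter.Tendsto (fun y : ℝ => F (x + y * Complex.I)) (𝓝[>] 0) (𝓝 (φ x)))
    {G : ℝ → ℝ → ℂ}
    (h : ∀ᵐ z : (ℝ × ℝ) × (ℝ × ℝ), 0 < z.1.1 * z.1.2 → 0 < z.2.1 → 0 < z.2.2 →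
      signedPhase φ z.1.1 z.1.2 z.2.1 z.2.2 = G (z.1.1 + z.1.2) (z.2.1 + z.2.2)) :
    IsSumInvariant fun x => F (x * Complex.I) := by
  set f : ℝ → ℂ := fun x => F (x * Complex.I) with hf
  let D : Set ((ℝ × ℝ) × (ℝ × ℝ)) :=
    (Set.Ioo 0 1 ×ˢ Set.Ioo 0 1) ×ˢ (Set.Ioi 0 ×ˢ Set.Ioi 0)
  have hD : IsOpen D := (isOpen_Ioo.prod isOpen_Ioo).prod (isOpen_Ioi.prod isOpen_Ioi)
  have hae : ∀ᵐ w : (ℝ × ℝ) × (ℝ × ℝ), w ∈ D →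
      crossProduct f w.1.1 (1 - w.1.1) w.2.1 w.2.2 =
        crossProduct f w.1.2 (1 - w.1.2) w.2.1 w.2.2 := by
    filter_upwards [ae_signedPhase_eq h] with w hw hwD
    obtain ⟨⟨⟨hx0, hx1⟩, ⟨hy0, hy1⟩⟩, ⟨ha, hb⟩⟩ := hwD
    have ha : 0 < w.2.1 := ha
    have hb : 0 < w.2.2 := hb
    have hx1' : 0 < 1 - w.1.1 := sub_pos.2 hx1
    have hy1' : 0 < 1 - w.1.2 := sub_pos.2 hy1
    -- Both sides are values at `i` of bounded holomorphic functions of `t` whose boundary values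
    -- agree almost everywhere.
    rw [hf, ← phaseExtension_I, ← phaseExtension_I]
    refine sub_eq_zero.1 (eq_zero_of_boundary_zero
      (H := fun z => phaseExtension F w.1.1 (1 - w.1.1) w.2.1 w.2.2 z -
        phaseExtension F w.1.2 (1 - w.1.2) w.2.1 w.2.2 z)
      ((differentiableOn_phaseExtension hF hx0 hx1' ha hb).sub
        (differentiableOn_phaseExtension hF hy0 hy1' ha hb))
      (fun z hz => (norm_sub_le _ _).trans (add_le_add
        (norm_phaseExtension_le hC hx0 hx1' ha hb hz)
        (norm_phaseExtension_le hC hy0 hy1' ha hb hz))) ?_ (by simp))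
    filter_upwards [hw, ae_tendsto_phaseExtension hlim hx0 hx1' ha hb,
      ae_tendsto_phaseExtension hlim hy0 hy1' ha hb] with t ht h1 h2
    have h3 := h1.sub h2
    rwa [ht ⟨hx0, hx1⟩ ⟨hy0, hy1⟩ ha hb, sub_self] at h3
  have hfc : ContinuousOn f (Set.Ioi 0) :=
    hF.continuousOn.comp (by fun_prop) fun x hx => by
      have hx : 0 < x := hx
      simpa using hx
  have hc : ∀ g : (ℝ × ℝ) × (ℝ × ℝ) → ℝ, Continuous g → (∀ w ∈ D, 0 < g w ∧ g w < 1) →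
      ContinuousOn (fun w => crossProduct f (g w) (1 - g w) w.2.1 w.2.2) D := by
    intro g hg hgD
    have h1 : ∀ u : (ℝ × ℝ) × (ℝ × ℝ) → ℝ, Continuous u → (∀ w ∈ D, 0 < u w) →
        ContinuousOn (fun w => f (u w)) D := fun u hu hpos =>
      hfc.comp hu.continuousOn hpos
    have hconj : ∀ u : (ℝ × ℝ) × (ℝ × ℝ) → ℂ, ContinuousOn u D →
        ContinuousOn (fun w => conj (u w)) D := fun u hu =>
      Complex.continuous_conj.comp_continuousOn hu
    have ha : ∀ w ∈ D, 0 < w.2.1 := fun w hw => hw.2.1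
    have hb : ∀ w ∈ D, 0 < w.2.2 := fun w hw => hw.2.2
    refine ((ContinuousOn.mul ?_ ?_).mul ?_).mul ?_
    · exact h1 _ (by fun_prop) fun w hw => mul_pos (hgD w hw).1 (ha w hw)
    · exact hconj _ (h1 _ (by fun_prop) fun w hw => mul_pos (hgD w hw).1 (hb w hw))
    · exact hconj _ (h1 _ (by fun_prop) fun w hw => mul_pos (sub_pos.2 (hgD w hw).2) (ha w hw))
    · exact h1 _ (by fun_prop) fun w hw => mul_pos (sub_pos.2 (hgD w hw).2) (hb w hw)
  -- Both sides are continuous on the open set `D`, so equality almost everywhere is equality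
  -- everywhere.
  have hall := Measure.eqOn_open_of_ae_eq ((ae_restrict_iff' hD.measurableSet).2 hae) hD
    (hc (fun w => w.1.1) (by fun_prop) fun w hw => hw.1.1)
    (hc (fun w => w.1.2) (by fun_prop) fun w hw => hw.1.2)
  intro p q p' q' a b hp hq hp' hq' ha hb hsum
  have hs : 0 < p + q := by positivity
  -- Only products of momenta enter, so the total `p + q` can be scaled to `1` by moving the factor
  -- to `a` and `b`.
  have hkey : ∀ r u : ℝ, r + u = p + q → crossProduct f r u a b =
      crossProduct f (r / (p + q)) (1 - r / (p + q)) ((p + q) * a) ((p + q) * b) := by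
    intro r u hru
    have hu : 1 - r / (p + q) = u / (p + q) := by
      rw [eq_div_iff hs.ne', sub_mul, div_mul_cancel₀ _ hs.ne']
      linarith
    rw [hu]
    have e : ∀ v c : ℝ, v / (p + q) * ((p + q) * c) = v * c := by
      intro v c
      field_simp
    simp only [crossProduct, e]
  rw [hkey p q rfl, hkey p' q' hsum.symm]
  refine hall (x := ((p / (p + q), p' / (p + q)), ((p + q) * a, (p + q) * b))) ?_
  refine ⟨⟨⟨by positivity, ?_⟩, ⟨by positivity, ?_⟩⟩, ⟨?_, ?_⟩⟩
  · exact (div_lt_one hs).2 (by linarith)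
  · exact (div_lt_one hs).2 (by linarith)
  · exact mul_pos hs ha
  · exact mul_pos hs hb

/-! ### The scattering operator on the `1+1` particle space -/

theorem fermiFock_ext {Φ Ψ : fermiFock} (h : ∀ n, (Φ : UnsymFock) n = (Ψ : UnsymFock) n) :
    Φ = Ψ :=
  Subtype.ext (lp.ext (funext h))

theorem scatteringOperator_apply {φ : ℝ → ℂ} (hφ : IsInnerFunction φ) (Φ : fermiFock) (n : ℕ × ℕ) :
    (scatteringOperator φ hφ Φ : UnsymFock) n =
      phaseMul (scatteringPhase_meas hφ n) (scatteringPhase_norm hφ n) ((Φ : UnsymFock) n) := rfl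

theorem gaugeOperator_apply (θ θ' : ℝ) (Φ : fermiFock) (n : ℕ × ℕ) :
    (gaugeOperator θ θ' Φ : UnsymFock) n =
      phaseMul (gaugePhase_meas θ θ' n) (gaugePhase_norm θ θ' n) ((Φ : UnsymFock) n) := rfl

theorem bosonEmbedding_apply_self (Ψ : BosonOneOne) :
    (bosonEmbedding Ψ : UnsymFock) (2, 2) = weightedComp isIsometricWeight_boson Ψ :=
  component_self _ _

theorem bosonEmbedding_apply_ne (Ψ : BosonOneOne) {n : ℕ × ℕ} (hn : n ≠ (2, 2)) :
    (bosonEmbedding Ψ : UnsymFock) n = 0 :=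
  component_ne hn _

/-- The total momenta of two pairs of modes. -/
abbrev totalMomenta (z : Config (2, 2)) : ℝ × ℝ := Prod.map pairMomentum pairMomentum z

/-- Only the `(2, 2)` component of an embedded vector is non-zero, and there everything is a
pointwise multiplication. -/
theorem scatteringOperator_bosonEmbedding_eq_iff {φ : ℝ → ℂ} (hφ : IsInnerFunction φ)
    (Ψ Ψ' : BosonOneOne) :
    scatteringOperator φ hφ (bosonEmbedding Ψ) = bosonEmbedding Ψ' ↔
      ∀ᵐ z ∂configMeasure (2, 2), scatteringPhase φ (2, 2) z *
        (pairWeight z.1 * pairWeight z.2 * Ψ (totalMomenta z)) =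
          pairWeight z.1 * pairWeight z.2 * Ψ' (totalMomenta z) := by
  have h1 := coeFn_weightedComp isIsometricWeight_boson Ψ
  have h2 := coeFn_weightedComp isIsometricWeight_boson Ψ'
  have h3 := coeFn_phaseMul (scatteringPhase_meas hφ (2, 2)) (scatteringPhase_norm hφ (2, 2))
    (weightedComp isIsometricWeight_boson Ψ)
  constructor
  · intro h
    have h4 : (scatteringOperator φ hφ (bosonEmbedding Ψ) : UnsymFock) (2, 2) =
        (bosonEmbedding Ψ' : UnsymFock) (2, 2) := by rw [h]
    rw [scatteringOperator_apply, bosonEmbedding_apply_self, bosonEmbedding_apply_self] at h4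
    rw [h4] at h3
    filter_upwards [h1, h2, h3] with z e1 e2 e3
    rw [← e1, ← e2, e3]
  · intro h
    refine fermiFock_ext fun n => ?_
    by_cases hn : n = (2, 2)
    · subst hn
      rw [scatteringOperator_apply, bosonEmbedding_apply_self, bosonEmbedding_apply_self]
      apply Lp.ext
      filter_upwards [h1, h2, h3, h] with z e1 e2 e3 e4
      rw [e3, e1, e2, e4]
    · rw [scatteringOperator_apply, bosonEmbedding_apply_ne _ hn, bosonEmbedding_apply_ne _ hn,
        map_zero]

theorem scatteringPhase_two_two (φ : ℝ → ℂ) (z : Config (2, 2)) :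
    scatteringPhase φ (2, 2) z =
      (twoParticlePhase φ (z.1 0, z.2 0) * twoParticlePhase φ (z.1 0, z.2 1)) *
        (twoParticlePhase φ (z.1 1, z.2 0) * twoParticlePhase φ (z.1 1, z.2 1)) := by
  refine (Fin.prod_univ_two _).trans ?_
  exact congrArg₂ _ (Fin.prod_univ_two _) (Fin.prod_univ_two _)

theorem charge_ne_of_pairWeight_ne_zero {x : Fin 2 → Mode} (h : pairWeight x ≠ 0) :
    (x 0).2 ≠ (x 1).2 := by
  intro he
  apply h
  simp [pairWeight, chargeSign, he]

theorem pairWeight_ne_zero {x : Fin 2 → Mode} (h : (x 0).2 ≠ (x 1).2) : pairWeight x ≠ 0 := by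
  unfold pairWeight chargeSign
  rw [if_neg h]
  refine mul_ne_zero ?_ (by split_ifs <;> simp)
  rw [Complex.ofReal_ne_zero]
  have := Real.pi_pos
  positivity

/-- The operator acts on the bosonic wave function as multiplication by `exp (i κ s s')`, where `s,
s'` are the total momenta. -/
theorem scatteringOperator_mem_of_isExponential {φ : ℝ → ℂ} (hφ : IsInnerFunction φ)
    (hexp : IsExponential φ) {Φ : fermiFock} (hΦ : Φ ∈ oneOneParticleSpace) :
    scatteringOperator φ hφ Φ ∈ oneOneParticleSpace := by
  obtain ⟨κ, θ, hκ⟩ := hexp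
  obtain ⟨Ψ, rfl⟩ := hΦ
  have hm : AEStronglyMeasurable (fun s : ℝ × ℝ => Complex.exp ((κ * (s.1 * s.2) : ℝ) * Complex.I))
      (bosonMeasure.prod bosonMeasure) :=
    (by fun_prop : Continuous fun s : ℝ × ℝ =>
      Complex.exp ((κ * (s.1 * s.2) : ℝ) * Complex.I)).aestronglyMeasurable
  have h1 : ∀ᵐ s ∂bosonMeasure.prod bosonMeasure,
      ‖Complex.exp ((κ * (s.1 * s.2) : ℝ) * Complex.I)‖ = 1 :=
    Filter.Eventually.of_forall fun s => Complex.norm_exp_ofReal_mul_I _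
  refine ⟨phaseMul hm h1 Ψ, ?_⟩
  refine ((scatteringOperator_bosonEmbedding_eq_iff hφ Ψ _).2 ?_).symm
  have hneg : Measure.QuasiMeasurePreserving (fun x : ℝ => -x) volume volume :=
    (Measure.measurePreserving_neg (volume : Measure ℝ)).quasiMeasurePreserving
  have htwo : ∀ᵐ w ∂modeMeasure.prod modeMeasure, twoParticlePhase φ w =
      Complex.exp (Complex.I * (κ * (w.1.1 * w.2.1) + (if w.1.2 = w.2.2 then 1 else -1) * θ)) := by
    filter_upwards [quasiMeasurePreserving_mul.ae hκ,
      (hneg.comp quasiMeasurePreserving_mul).ae hκ] with w e1 e2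
    simp only [Function.comp_apply] at e2
    unfold twoParticlePhase check
    split_ifs
    · rw [e1]
      push_cast
      ring_nf
    · rw [e2, ← Complex.exp_conj]
      simp only [map_mul, map_add, Complex.conj_I, Complex.conj_ofReal]
      push_cast
      ring_nf
  have hall : ∀ i j : Fin 2, ∀ᵐ z ∂configMeasure (2, 2), twoParticlePhase φ (z.1 i, z.2 j) = _ :=
    fun i j => (quasiMeasurePreserving_pair (2, 2) i j).ae htwo
  filter_upwards [isIsometricWeight_boson.qmp.ae (coeFn_phaseMul hm h1 Ψ), hall 0 0, hall 0 1,
    hall 1 0, hall 1 1] with z e0 e1 e2 e3 e4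
  rw [e0]
  by_cases hw1 : pairWeight z.1 = 0
  · simp [hw1]
  by_cases hw2 : pairWeight z.2 = 0
  · simp [hw2]
  have c1 := charge_ne_of_pairWeight_ne_zero hw1
  have c2 := charge_ne_of_pairWeight_ne_zero hw2
  have hphase : scatteringPhase φ (2, 2) z = Complex.exp
      ((κ * (pairMomentum z.1 * pairMomentum z.2) : ℝ) * Complex.I) := by
    -- Among the four pairs formed from two opposite-charge pairs, two have equal and two have
    -- opposite charges, so `θ` cancels.
    have key : ∀ x₀ x₁ y₀ y₁ : Mode, x₀.2 ≠ x₁.2 → y₀.2 ≠ y₁.2 →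
        Complex.I * (κ * (x₀.1 * y₀.1) + (if x₀.2 = y₀.2 then 1 else -1) * θ) +
          Complex.I * (κ * (x₀.1 * y₁.1) + (if x₀.2 = y₁.2 then 1 else -1) * θ) +
          (Complex.I * (κ * (x₁.1 * y₀.1) + (if x₁.2 = y₀.2 then 1 else -1) * θ) +
            Complex.I * (κ * (x₁.1 * y₁.1) + (if x₁.2 = y₁.2 then 1 else -1) * θ)) =
        ((κ * ((x₀.1 + x₁.1) * (y₀.1 + y₁.1)) : ℝ) : ℂ) * Complex.I := by
      rintro ⟨p, _ | _⟩ ⟨q, _ | _⟩ ⟨a, _ | _⟩ ⟨b, _ | _⟩ c1 c2 <;> simp at c1 c2 ⊢ <;> ring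
    rw [scatteringPhase_two_two, e1, e2, e3, e4, ← Complex.exp_add, ← Complex.exp_add,
      ← Complex.exp_add]
    exact congrArg Complex.exp (key _ _ _ _ c1 c2)
  rw [hphase]
  simp only [totalMomenta, Prod.map]
  ring

/-! ### Invariance of the space forces an exponential -/

/-- Two modes with momenta `x` and charges `s` and `t`. -/
def modePair (s t : Bool) (x : ℝ × ℝ) : Fin 2 → Mode := ![(x.1, s), (x.2, t)]

/-- Each charge is an atom of the counting measure, so a null set of modes has null slices at fixed
charge. -/
theorem quasiMeasurePreserving_modePair (s t : Bool) : Measure.QuasiMeasurePreserving (modePair s t)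
    (((volume : Measure ℝ).restrict (Set.Ioi 0)).prod (volume.restrict (Set.Ioi 0)))
    (Measure.pi fun _ => modeMeasure) := by
  have h1 : ∀ s : Bool, Measure.QuasiMeasurePreserving (fun p : ℝ => ((p, s) : Mode))
      ((volume : Measure ℝ).restrict (Set.Ioi 0)) modeMeasure := by
    intro s
    refine ⟨by fun_prop, Measure.AbsolutelyContinuous.mk fun A hA h0 => ?_⟩
    have hac : (volume : Measure ℝ).restrict (Set.Ioi 0) ≪ momentumMeasure := by
      unfold momentumMeasure
      refine Measure.absolutelyContinuous_smul ?_
      simpa using Real.pi_pos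
    rw [Measure.map_apply (by fun_prop) hA]
    apply hac
    unfold modeMeasure at h0
    rw [Measure.prod_apply_symm hA, lintegral_count, ENNReal.tsum_eq_zero] at h0
    exact h0 s
  have h2 := (measurePreserving_finTwoArrow modeMeasure).symm.quasiMeasurePreserving.comp
    (QuasiMeasurePreserving.prodMap (h1 s) (h1 t))
  convert! h2 using 1

theorem ae_modePair {P : Config (2, 2) → Prop} (h : ∀ᵐ z ∂configMeasure (2, 2), P z)
    (s t s' t' : Bool) : ∀ᵐ z : (ℝ × ℝ) × (ℝ × ℝ), 0 < z.1.1 → 0 < z.1.2 → 0 < z.2.1 → 0 < z.2.2 →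
      P (modePair s t z.1, modePair s' t' z.2) := by
  have h1 := (QuasiMeasurePreserving.prodMap (quasiMeasurePreserving_modePair s t)
    (quasiMeasurePreserving_modePair s' t')).ae h
  rw [Measure.prod_restrict, Measure.prod_restrict, ae_restrict_iff'
    ((measurableSet_Ioi.prod measurableSet_Ioi).prod (measurableSet_Ioi.prod measurableSet_Ioi))]
    at h1
  filter_upwards [h1] with z hz e1 e2 e3 e4
  exact hz ⟨⟨e1, e2⟩, ⟨e3, e4⟩⟩

theorem scatteringPhase_modePair (φ : ℝ → ℂ) (x y : ℝ × ℝ) :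
    scatteringPhase φ (2, 2) (modePair true false x, modePair true false y) =
      signedPhase φ x.1 x.2 y.1 y.2 := by
  rw [scatteringPhase_two_two]
  simp only [modePair, twoParticlePhase, signedPhase, Matrix.cons_val_zero, Matrix.cons_val_one,
    Bool.true_eq_false, Bool.false_eq_true, if_true, if_false, mul_assoc]

/-- Swapping the charges of the first pair exchanges `φ` and `check φ`, which are conjugates of each
other at opposite arguments. This order of charges thus supplies the phase at negative momenta. -/
theorem scatteringPhase_modePair_flip (φ : ℝ → ℂ) (x y : ℝ × ℝ) :
    scatteringPhase φ (2, 2) (modePair false true x, modePair true false y) =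
      conj (signedPhase φ (-x.1) (-x.2) y.1 y.2) := by
  rw [scatteringPhase_two_two]
  simp [modePair, twoParticlePhase, signedPhase, check]
  ring

/-- The square root of a strictly positive integrable function. With such a wave function the phase
can be recovered by division, so one vector tests invariance. -/
theorem exists_ae_ne_zero : ∃ Ψ : BosonOneOne,
    ∀ᵐ s ∂bosonMeasure.prod bosonMeasure, Ψ s ≠ 0 := by
  obtain ⟨g, hg0, hgm, hg⟩ := exists_pos_lintegral_lt_of_sigmaFinite
    (bosonMeasure.prod bosonMeasure) (one_ne_zero (α := ℝ≥0∞))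
  have hm : MemLp (fun s => ((√(g s : ℝ) : ℝ) : ℂ)) 2 (bosonMeasure.prod bosonMeasure) := by
    have hmeas : Measurable fun s => ((√(g s : ℝ) : ℝ) : ℂ) := by fun_prop
    refine ⟨hmeas.aestronglyMeasurable, ?_⟩
    rw [eLpNorm_lt_top_iff_lintegral_rpow_enorm_lt_top (by norm_num) (by norm_num)]
    refine lt_of_eq_of_lt (lintegral_congr fun s => ?_) (hg.trans ENNReal.one_lt_top)
    rw [← ofReal_norm, Complex.norm_real, Real.norm_of_nonneg (Real.sqrt_nonneg _),
      ENNReal.ofReal_rpow_of_nonneg (Real.sqrt_nonneg _) (by norm_num)]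
    simp
  refine ⟨hm.toLp, ?_⟩
  filter_upwards [hm.coeFn_toLp] with s hs
  rw [hs, Complex.ofReal_ne_zero]
  exact (Real.sqrt_pos.2 (hg0 s)).ne'

theorem isExponential_of_scatteringOperator_mem {φ : ℝ → ℂ} (hφ : IsInnerFunction φ)
    (h : ∀ Φ ∈ oneOneParticleSpace, scatteringOperator φ hφ Φ ∈ oneOneParticleSpace) :
    IsExponential φ := by
  obtain ⟨Ψ, hΨ⟩ := exists_ae_ne_zero
  obtain ⟨Ψ', hΨ'⟩ := h (bosonEmbedding Ψ) ⟨Ψ, rfl⟩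
  have h1 := (scatteringOperator_bosonEmbedding_eq_iff hφ Ψ Ψ').1 hΨ'.symm
  have h2 : ∀ᵐ z ∂configMeasure (2, 2), pairWeight z.1 ≠ 0 → pairWeight z.2 ≠ 0 →
      scatteringPhase φ (2, 2) z = Ψ' (totalMomenta z) / Ψ (totalMomenta z) := by
    filter_upwards [h1, isIsometricWeight_boson.qmp.ae hΨ] with z e1 e2 w1 w2
    rw [eq_div_iff e2]
    apply mul_left_cancel₀ (mul_ne_zero w1 w2)
    rw [← e1]
    ring
  let g : ℝ → ℝ → ℂ := fun s t => Ψ' (s, t) / Ψ (s, t)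
  have hmom : ∀ s t s' t' x y, totalMomenta (modePair s t x, modePair s' t' y) =
      (x.1 + x.2, y.1 + y.2) := fun s t s' t' x y => rfl
  have h3 := ae_modePair h2 true false true false
  have h4 := ae_modePair h2 false true true false
  -- Change the sign of both momenta in the first factor, to read the `(-,+)` relation at negative
  -- momenta.
  let N : (ℝ × ℝ) × (ℝ × ℝ) →ₗ[ℝ] (ℝ × ℝ) × (ℝ × ℝ) := LinearMap.prodMap (-LinearMap.id) LinearMap.id
  have hi : (volume : Measure ((ℝ × ℝ) × (ℝ × ℝ))).IsAddHaarMeasure :=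
    Measure.prod.instIsAddHaarMeasure _ _
  have hN : Measure.QuasiMeasurePreserving N volume volume :=
    quasiMeasurePreserving_linear _ _ N fun y => ⟨(-y.1, y.2), by simp [N]⟩
  have h5 := hN.ae h4
  obtain ⟨F, hF, ⟨C, hC⟩, hlim⟩ := hφ
  -- For negative total momentum `s`, the `(-,+)` relation at `-s` is conjugated.
  refine isExponential_of_isSumInvariant hF hlim (isSumInvariant_of_ae hF hC
    (hlim.mono fun x hx => hx.1)
    (G := fun s t => if 0 < s then g s t else conj (g (-s) t)) ?_)
  filter_upwards [h3, h5] with z e3 e5 hpq ha hb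
  rcases pos_and_pos_or_neg_and_neg_of_mul_pos hpq with ⟨hp, hq⟩ | ⟨hp, hq⟩
  · have := e3 hp hq ha hb (pairWeight_ne_zero (by simp [modePair]))
      (pairWeight_ne_zero (by simp [modePair]))
    rw [scatteringPhase_modePair, hmom] at this
    rw [if_pos (add_pos hp hq), this]
  · have := e5 (neg_pos.2 hp) (neg_pos.2 hq) ha hb (pairWeight_ne_zero (by simp [modePair]))
      (pairWeight_ne_zero (by simp [modePair]))
    rw [scatteringPhase_modePair_flip, hmom] at this
    change conj (signedPhase φ (- -z.1.1) (- -z.1.2) z.2.1 z.2.2) =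
      g (-z.1.1 + -z.1.2) (z.2.1 + z.2.2) at this
    rw [neg_neg, neg_neg] at this
    rw [if_neg (by linarith), neg_add, ← this, Complex.conj_conj]

/-! ### Gauge invariance and mixing of particle numbers -/

theorem phaseMul_comm {Y : Type*} [MeasurableSpace Y] {μ : Measure Y} {m m' : Y → ℂ}
    (hm : AEStronglyMeasurable m μ) (h1 : ∀ᵐ y ∂μ, ‖m y‖ = 1)
    (hm' : AEStronglyMeasurable m' μ) (h1' : ∀ᵐ y ∂μ, ‖m' y‖ = 1) (f : Lp ℂ 2 μ) :
    phaseMul hm h1 (phaseMul hm' h1' f) = phaseMul hm' h1' (phaseMul hm h1 f) := by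
  apply Lp.ext
  filter_upwards [coeFn_phaseMul hm h1 (phaseMul hm' h1' f), coeFn_phaseMul hm' h1' f,
    coeFn_phaseMul hm' h1' (phaseMul hm h1 f), coeFn_phaseMul hm h1 f] with y e1 e2 e3 e4
  rw [e1, e2, e3, e4]
  ring

theorem scatteringOperator_mem_bosonFock {φ : ℝ → ℂ} (hφ : IsInnerFunction φ) {Φ : fermiFock}
    (hΦ : Φ ∈ bosonFock) : scatteringOperator φ hφ Φ ∈ bosonFock := by
  intro θ θ'
  have hcomm : gaugeOperator θ θ' (scatteringOperator φ hφ Φ) =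
      scatteringOperator φ hφ (gaugeOperator θ θ' Φ) := by
    refine fermiFock_ext fun n => ?_
    simp only [gaugeOperator_apply, scatteringOperator_apply]
    exact phaseMul_comm _ _ _ _ _
  rw [hcomm, hΦ θ θ']

theorem oneOneParticleSpace_le_bosonFock : oneOneParticleSpace ≤ bosonFock := by
  rintro _ ⟨Ψ, rfl⟩ θ θ'
  refine fermiFock_ext fun n => ?_
  rw [gaugeOperator_apply]
  change phaseMul _ _ ((bosonEmbedding Ψ : UnsymFock) n) = (bosonEmbedding Ψ : UnsymFock) n
  by_cases hn : n = (2, 2)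
  · subst hn
    rw [bosonEmbedding_apply_self]
    apply Lp.ext
    filter_upwards [coeFn_phaseMul (gaugePhase_meas θ θ' (2, 2)) (gaugePhase_norm θ θ' (2, 2))
      (weightedComp isIsometricWeight_boson Ψ),
      coeFn_weightedComp isIsometricWeight_boson Ψ] with z e1 e2
    rw [e1, e2]
    by_cases hw1 : pairWeight z.1 = 0
    · simp [hw1]
    by_cases hw2 : pairWeight z.2 = 0
    · simp [hw2]
    -- Opposite charges acquire inverse phases; elsewhere the wave function vanishes.
    have hone : ∀ (t : ℝ) (x : Fin 2 → Mode), (x 0).2 ≠ (x 1).2 →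
        ∏ i, modePhase t (x i) = 1 := by
      intro t x hx
      rw [Fin.prod_univ_two]
      unfold modePhase
      rw [← Complex.exp_add, ← mul_add, ← Complex.ofReal_add]
      generalize (x 0).2 = b, (x 1).2 = c at *
      cases b <;> cases c <;> simp at hx ⊢
    have hg : gaugePhase θ θ' (2, 2) z = 1 * 1 := congrArg₂ _
      (hone θ z.1 (charge_ne_of_pairWeight_ne_zero hw1))
      (hone θ' z.2 (charge_ne_of_pairWeight_ne_zero hw2))
    rw [hg, one_mul, one_mul]
  · rw [bosonEmbedding_apply_ne _ hn, map_zero]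

/-- Some vector leaves the `1+1` particle space; `Φ` is the orthogonal projection of its image and
`X` the remainder, non-zero because the image is outside and gauge invariant because the image and
`Φ` are. -/
theorem exists_mixing {φ : ℝ → ℂ} (hφ : IsInnerFunction φ) (h : ¬ IsExponential φ) :
    ∃ Ψ ∈ oneOneParticleSpace, ∃ Φ ∈ oneOneParticleSpace, ∃ X ∈ oneOneParticleSpaceᗮ ⊓ bosonFock,
      X ≠ 0 ∧ scatteringOperator φ hφ Ψ = Φ + X := by
  obtain ⟨Ψ, hΨ, hS⟩ : ∃ Ψ ∈ oneOneParticleSpace,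
      scatteringOperator φ hφ Ψ ∉ oneOneParticleSpace := by
    by_contra! hall
    exact h (isExponential_of_scatteringOperator_mem hφ hall)
  -- The range of an isometry on a complete space is complete, which the projection requires.
  have hcomplete : CompleteSpace oneOneParticleSpace :=
    (bosonEmbedding.isometry.isUniformInducing.isComplete_range).completeSpace_coe
  obtain ⟨Φ, hΦ, X, hX, hsum⟩ :=
    oneOneParticleSpace.exists_add_mem_mem_orthogonal (scatteringOperator φ hφ Ψ)
  refine ⟨Ψ, hΨ, Φ, hΦ, X, ⟨hX, ?_⟩, ?_, hsum⟩
  · have hXe : X = scatteringOperator φ hφ Ψ - Φ := by rw [hsum, add_sub_cancel_left]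
    rw [hXe]
    exact bosonFock.sub_mem
      (scatteringOperator_mem_bosonFock hφ (oneOneParticleSpace_le_bosonFock hΨ))
      (oneOneParticleSpace_le_bosonFock hΦ)
  · rintro rfl
    rw [add_zero] at hsum
    exact hS (hsum ▸ hΦ)

end FermiScattering

theorem mainTheorem3 (φ : ℝ → ℂ) (hφ : IsInnerFunction φ) :
    ((∀ Ψ ∈ oneOneParticleSpace, scatteringOperator φ hφ Ψ ∈ oneOneParticleSpace) ↔
      IsExponential φ) ∧
    (¬ IsExponential φ →
      ∃ Ψ ∈ oneOneParticleSpace,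
        ∃ Φ ∈ oneOneParticleSpace, ∃ X ∈ oneOneParticleSpaceᗮ ⊓ bosonFock,
          X ≠ 0 ∧ scatteringOperator φ hφ Ψ = Φ + X) :=
  ⟨⟨isExponential_of_scatteringOperator_mem hφ,
    fun h _ hΨ => scatteringOperator_mem_of_isExponential hφ h hΨ⟩, exists_mixing hφ⟩
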